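/- A set $S \subset \mathbb{R}^d$ is in general position if, for every $k < d$, every $k$-dimensional affine subspace of $\mathbb{R}^d$ contains at most $k+1$ points of $S$. A set $T \subset \mathbb{R}^d$ is $\ell$-hole-free if, for any $\ell$ distinct points $t_1, \dots, t_\ell \in T$, there is a point $t \in T$ (possibly one of the $t_i$) in the interior of the convex hull of $\{t_1, \dots, t_\ell\}$. **Theorem.** For each integer $d \geq 2$ there is a positive integer $C_d$, with $C_2 = 9$ and $C_d = d^{O(d^3)}$ (that is, there is an absolute constant $K$ such that $C_d \leq d^{K d^3}$ for all $d \geq 2$), with the following property. For every finite set $S \subset \mathbb{R}^d$ in general position and every natural number $n$, there is a finite set $T \supseteq S$ in general position with $|T| \geq n$ that is $C_d$-hole-free. -/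

import Mathlib

/-- A set `S ⊆ ℝ^d` is in general position if, for every `k < d`, every `k`-dimensional affine
subspace of `ℝ^d` contains at most `k + 1` points of `S`. -/
def InGeneralPosition {d : ℕ} (S : Set (EuclideanSpace ℝ (Fin d))) : Prop :=
  ∀ k : ℕ, k < d → ∀ V : AffineSubspace ℝ (EuclideanSpace ℝ (Fin d)),
    Module.finrank ℝ V.direction = k →
      (S ∩ (V : Set (EuclideanSpace ℝ (Fin d)))).encard ≤ ((k + 1 : ℕ) : ℕ∞)

/-- A set `T ⊆ ℝ^d` (not necessarily in general position) is `ℓ`-hole-free if, for any `ℓ`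
distinct points of `T`, some point of `T` lies in the interior of their convex hull. The `ℓ` points
need not be in convex position, and the interior point may be one of them. -/
def HoleFree {d : ℕ} (l : ℕ) (T : Set (EuclideanSpace ℝ (Fin d))) : Prop :=
  ∀ A : Finset (EuclideanSpace ℝ (Fin d)),
    (A : Set (EuclideanSpace ℝ (Fin d))) ⊆ T → A.card = l →
      ∃ s ∈ T, s ∈ interior (convexHull ℝ (A : Set (EuclideanSpace ℝ (Fin d))))

/-! Add to `S` a large cube of a very fine lattice, slightly perturbed. Suppose the perturbed cube
is `Crowded`: any `c` of its points have a point of the cube in the interior of their hull. Then `c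
+ d` points of `T` include either `d + 1` points of `S`, whose simplex has room for a point of the
fine cube, or `c` points of the cube (`exists_holeFree_superset`). Crowding is an open condition, so
a last tiny move gives general position.

In an unperturbed lattice, congruences among many points force a lattice point `q` to be a positive
combination of some of them, but the hull may be flat. The perturbation must open the missing
directions. Move each `z` by `h z • v`, with `h` lexicographic in the residues of `z` modulo `p`, `p
^ 2`, and so on. If `q` is separated from the points both below and above in this order, the
relation at `q` can be modified in two ways, so that its lifts are a negative and a positive
multiple of `v`. Combining the two balances `q` again and puts `v` in the span
(`TiltedAt.balancedAt`, `exists_height`). This is repeated for the `d` coordinate directions with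
`d` distinct primes (`exists_iterated_perturbation`). The Chinese remainder theorem finds one `q`
suited to all primes at once, and a loss of dimension restarts the search at most `d` times
(`exists_separating_balanced`). Choosing the first `d` primes, all at most `d ^ 4` for `d ≥ 3`,
gives the bound.

In the plane one direction and the prime 2 suffice. Seven lattice points surround a lattice point
unless four are collinear. In that case a tilt along the line, to one side or to both, supplies the
missing direction. This gives `c = 7` and `C 2 = 7 + 2`. -/

/-! ### Surrounded points, their stability, and positive relations. -/

section Surrounding

variable {ι E : Type*} [NormedAddCommGroup E] [InnerProductSpace ℝ E]

/-- The points `π a`, `a ∈ A`, surround `π q`: every open half-space with `π q` on its boundary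
contains one of them. -/
def Surrounds (π : ι → E) (A : Finset ι) (q : ι) : Prop :=
  ∀ y : E, y ≠ 0 → ∃ a ∈ A, 0 < inner ℝ y (π a - π q)

theorem Surrounds.mono {π : ι → E} {A B : Finset ι} {q : ι} (h : Surrounds π A q) (hAB : A ⊆ B) :
    Surrounds π B q := fun y hy =>
  let ⟨a, ha, h'⟩ := h y hy
  ⟨a, hAB ha, h'⟩

/-- The largest of the inner products is continuous and positive on the compact unit sphere;
homogeneity does the rest. The margin serves both as the radius of a ball in the hull and as a
tolerance for perturbations. -/
theorem Surrounds.exists_margin [FiniteDimensional ℝ E] [Nontrivial E] {π : ι → E} {A : Finset ι}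
    {q : ι} (h : Surrounds π A q) :
    ∃ m : ℝ, 0 < m ∧ ∀ y : E, ∃ a ∈ A, m * ‖y‖ ≤ inner ℝ y (π a - π q) := by
  obtain ⟨y₀, hy₀⟩ := exists_ne (0 : E)
  have hA : A.Nonempty := let ⟨a, ha, _⟩ := h y₀ hy₀; ⟨a, ha⟩
  let F : E → ℝ := fun y => A.sup' hA fun a => inner ℝ y (π a - π q)
  have hF : Continuous F :=
    Continuous.finset_sup'_apply hA fun a _ => by fun_prop
  have hne : (Metric.sphere (0 : E) 1).Nonempty := NormedSpace.sphere_nonempty.2 zero_le_one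
  obtain ⟨z, hz, hmin⟩ := (isCompact_sphere (0 : E) 1).exists_isMinOn hne hF.continuousOn
  have hz1 : ‖z‖ = 1 := by simpa using hz
  refine ⟨F z, ?_, fun y => ?_⟩
  · obtain ⟨a, ha, h'⟩ := h z (by rintro rfl; simp at hz1)
    exact (Finset.lt_sup'_iff hA).2 ⟨a, ha, h'⟩
  · by_cases hy : y = 0
    · obtain ⟨a, ha⟩ := hA
      exact ⟨a, ha, by simp [hy]⟩
    · have hy' : 0 < ‖y‖ := norm_pos_iff.2 hy
      have hmem : (‖y‖⁻¹ • y) ∈ Metric.sphere (0 : E) 1 := by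
        simp [norm_smul, hy'.ne']
      have h1 : F z ≤ F (‖y‖⁻¹ • y) := hmin hmem
      obtain ⟨a, ha, h2⟩ := Finset.exists_mem_eq_sup' hA
        fun a => (inner ℝ (‖y‖⁻¹ • y) (π a - π q) : ℝ)
      refine ⟨a, ha, ?_⟩
      have h3 : F z ≤ ‖y‖⁻¹ * inner ℝ y (π a - π q) := by
        rw [← real_inner_smul_left]
        exact h1.trans h2.le
      rw [inv_mul_eq_div, le_div_iff₀ hy'] at h3
      exact h3

theorem Surrounds.mem_interior [FiniteDimensional ℝ E] [Nontrivial E] {π : ι → E} {A : Finset ι}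
    {q : ι} (h : Surrounds π A q) : π q ∈ interior (convexHull ℝ (π '' A)) := by
  obtain ⟨m, hm, hA⟩ := h.exists_margin
  refine _root_.mem_interior.2 ⟨Metric.ball (π q) m, fun x hx => ?_, Metric.isOpen_ball,
    Metric.mem_ball_self hm⟩
  by_contra hx'
  obtain ⟨f, u, hf, hu⟩ := geometric_hahn_banach_closed_point (convex_convexHull ℝ _)
    ((A.finite_toSet.image π).isClosed_convexHull ℝ) hx'
  have hrep : ∀ z, f z = inner ℝ ((InnerProductSpace.toDual ℝ E).symm f) z := fun z => by simp
  set y := (InnerProductSpace.toDual ℝ E).symm f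
  obtain ⟨a, ha, h1⟩ := hA y
  have h2 : f (π a) < f x := (hf _ (subset_convexHull ℝ _ ⟨a, ha, rfl⟩)).trans hu
  have h3 : inner ℝ y (x - π q) ≤ ‖y‖ * ‖x - π q‖ := real_inner_le_norm _ _
  have h4 : ‖x - π q‖ < m := by rwa [Metric.mem_ball, dist_eq_norm] at hx
  have h5 : inner ℝ y (π a - π q) < inner ℝ y (x - π q) := by
    rw [inner_sub_right, inner_sub_right, ← hrep, ← hrep, ← hrep]; linarith
  have h6 : ‖y‖ * ‖x - π q‖ ≤ m * ‖y‖ := by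
    rw [mul_comm]; exact mul_le_mul_of_nonneg_right h4.le (norm_nonneg _)
  linarith

theorem Surrounds.of_near [FiniteDimensional ℝ E] [Nontrivial E] {π : ι → E} {A : Finset ι}
    {q : ι} (h : Surrounds π A q) :
    ∃ ε : ℝ, 0 < ε ∧ ∀ π' : ι → E, (∀ a ∈ A, ‖π' a - π a‖ < ε) → ‖π' q - π q‖ < ε →
      Surrounds π' A q := by
  obtain ⟨m, hm, hA⟩ := h.exists_margin
  refine ⟨m / 2, half_pos hm, fun π' h1 h2 y hy => ?_⟩
  obtain ⟨a, ha, h3⟩ := hA y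
  refine ⟨a, ha, ?_⟩
  have hy' : 0 < ‖y‖ := norm_pos_iff.2 hy
  have h4 : π' a - π' q = (π a - π q) + ((π' a - π a) - (π' q - π q)) := by abel
  have h5 : ‖(π' a - π a) - (π' q - π q)‖ < m :=
    (norm_sub_le _ _).trans_lt (by linarith [h1 a ha])
  have h6 := abs_real_inner_le_norm y ((π' a - π a) - (π' q - π q))
  have h7 : ‖y‖ * ‖(π' a - π a) - (π' q - π q)‖ < ‖y‖ * m := mul_lt_mul_of_pos_left h5 hy'
  rw [h4, inner_add_right]
  have := (abs_le.1 h6).1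
  linarith [mul_comm m ‖y‖]

/-- Every `c`-element subfamily of the family `π` on `G` surrounds one of its points. -/
def Crowded (π : ι → E) (G : Finset ι) (c : ℕ) : Prop :=
  ∀ A ⊆ G, A.card = c → ∃ q ∈ G, Surrounds π A q

theorem Crowded.of_near [FiniteDimensional ℝ E] [Nontrivial E] {π : ι → E} {G : Finset ι} {c : ℕ}
    (h : Crowded π G c) :
    ∃ ε : ℝ, 0 < ε ∧ ∀ π' : ι → E, (∀ z ∈ G, ‖π' z - π z‖ < ε) → Crowded π' G c := by
  have key : ∀ A ∈ G.powersetCard c, ∀ᶠ ε in nhdsWithin (0 : ℝ) (Set.Ioi 0),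
      ∀ π' : ι → E, (∀ z ∈ G, ‖π' z - π z‖ < ε) → ∃ q ∈ G, Surrounds π' A q := by
    intro A hA
    obtain ⟨hAG, hc⟩ := Finset.mem_powersetCard.1 hA
    obtain ⟨q, hq, hs⟩ := h A hAG hc
    obtain ⟨ε, hε, H⟩ := hs.of_near
    filter_upwards [Ioo_mem_nhdsGT hε] with η hη π' hπ'
    exact ⟨q, hq, H π' (fun a ha => (hπ' a (hAG ha)).trans hη.2) ((hπ' q hq).trans hη.2)⟩
  obtain ⟨ε, h1, h2⟩ := (((Finset.eventually_all _).2 key).and self_mem_nhdsWithin).exists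
  exact ⟨ε, h2, fun π' hπ' A hA hc => h1 A (Finset.mem_powersetCard.2 ⟨hA, hc⟩) π' hπ'⟩

/-- A positive linear relation among the vectors `π a - π q`, `a ∈ C`. -/
def BalancedAt (π : ι → E) (C : Finset ι) (q : ι) : Prop :=
  ∃ t : ι → ℝ, (∀ a ∈ C, 0 < t a) ∧ ∑ a ∈ C, t a • (π a - π q) = 0

/-- The span of the vectors `π a - π q`, `a ∈ C`. -/
def spread (π : ι → E) (C : Finset ι) (q : ι) : Submodule ℝ E :=
  Submodule.span ℝ ((fun a => π a - π q) '' C)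

theorem sub_mem_spread {π : ι → E} {C : Finset ι} {q a : ι} (ha : a ∈ C) :
    π a - π q ∈ spread π C q := Submodule.subset_span ⟨a, ha, rfl⟩

theorem spread_mono {π : ι → E} {C C' : Finset ι} {q : ι} (h : C ⊆ C') :
    spread π C q ≤ spread π C' q :=
  Submodule.span_mono (Set.image_mono (by exact_mod_cast h))

/-- A positive combination of nonpositive numbers vanishes only if each of them does, so a
half-space missing the family must be orthogonal to its span. -/
theorem BalancedAt.inner_eq_zero {π : ι → E} {C : Finset ι} {q : ι} (h : BalancedAt π C q) {y : E}
    (hy : ∀ a ∈ C, inner ℝ y (π a - π q) ≤ 0) {x : E} (hx : x ∈ spread π C q) :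
    inner ℝ y x = 0 := by
  obtain ⟨t, ht, hsum⟩ := h
  have h1 : ∑ a ∈ C, t a * inner ℝ y (π a - π q) = 0 := by
    rw [← inner_zero_right (𝕜 := ℝ) y, ← hsum, inner_sum]
    simp [real_inner_smul_right]
  have h2 : ∀ a ∈ C, t a * inner ℝ y (π a - π q) = 0 :=
    (Finset.sum_eq_zero_iff_of_nonpos fun a ha =>
      mul_nonpos_of_nonneg_of_nonpos (ht a ha).le (hy a ha)).1 h1
  have h3 : spread π C q ≤ LinearMap.ker (innerₛₗ ℝ y) := by
    refine Submodule.span_le.2 ?_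
    rintro _ ⟨a, ha, rfl⟩
    simpa [(ht a ha).ne'] using h2 a ha
  simpa using h3 hx

theorem BalancedAt.surrounds {π : ι → E} {C : Finset ι} {q : ι} (h : BalancedAt π C q)
    (hs : spread π C q = ⊤) : Surrounds π C q := by
  intro y hy
  by_contra! hcon
  exact hy (inner_self_eq_zero.1 (h.inner_eq_zero hcon (hs ▸ Submodule.mem_top)))

end Surrounding

/-! ### General position by small moves. -/

section GeneralPosition

open MeasureTheory

variable {d : ℕ}

theorem InGeneralPosition.le_finrank_vectorSpan {S : Set (EuclideanSpace ℝ (Fin d))}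
    (hS : InGeneralPosition S) {s : Finset (EuclideanSpace ℝ (Fin d))} (hs : ↑s ⊆ S)
    {k : ℕ} (hk : k ≤ d) (hcard : s.card = k + 1) :
    k ≤ Module.finrank ℝ (vectorSpan ℝ (s : Set (EuclideanSpace ℝ (Fin d)))) := by
  by_contra! hlt
  have h1 := hS _ (hlt.trans_le hk) (affineSpan ℝ (s : Set (EuclideanSpace ℝ (Fin d))))
    (by rw [direction_affineSpan])
  have h2 : (s : Set (EuclideanSpace ℝ (Fin d))) ⊆
      S ∩ (affineSpan ℝ (s : Set (EuclideanSpace ℝ (Fin d))) : Set _) :=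
    Set.subset_inter hs (subset_affineSpan ℝ _)
  have h3 := (Set.encard_le_encard h2).trans h1
  rw [Set.encard_coe_eq_coe_finsetCard, hcard, Nat.cast_le] at h3
  omega

theorem InGeneralPosition.affineSpan_eq_top {S : Set (EuclideanSpace ℝ (Fin d))}
    (hS : InGeneralPosition S) {s : Finset (EuclideanSpace ℝ (Fin d))} (hs : ↑s ⊆ S)
    (hcard : s.card = d + 1) :
    affineSpan ℝ (s : Set (EuclideanSpace ℝ (Fin d))) = ⊤ := by
  have hne : (s : Set (EuclideanSpace ℝ (Fin d))).Nonempty := by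
    rw [Finset.coe_nonempty, ← Finset.card_pos]; omega
  rw [← AffineSubspace.direction_eq_top_iff_of_nonempty
    ((affineSpan_nonempty ℝ).2 hne), direction_affineSpan]
  refine Submodule.eq_top_of_finrank_eq (le_antisymm (Submodule.finrank_le _) ?_)
  rw [finrank_euclideanSpace_fin]
  exact hS.le_finrank_vectorSpan hs le_rfl hcard

theorem affineSpan_ne_top_of_card_le {s : Finset (EuclideanSpace ℝ (Fin d))}
    (hcard : s.card ≤ d) :
    affineSpan ℝ (s : Set (EuclideanSpace ℝ (Fin d))) ≠ ⊤ := by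
  intro h
  rcases s.eq_empty_or_nonempty with rfl | hne
  · simp at h
  · have h1 : vectorSpan ℝ (s : Set (EuclideanSpace ℝ (Fin d))) = ⊤ := by
      rw [← direction_affineSpan, h, AffineSubspace.direction_top]
    have hpos := Finset.card_pos.2 hne
    have h2 := finrank_vectorSpan_image_finset_le ℝ (id : EuclideanSpace ℝ (Fin d) → _) s
      (n := s.card - 1) (by omega)
    rw [Finset.image_id, h1, finrank_top, finrank_euclideanSpace_fin] at h2
    omega

/-- If a `k`-dimensional `V` through `x` held `k + 1` old points, these would already span `V`, and
`x` would lie in the span of at most `d` old points. -/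
theorem InGeneralPosition.insert_of_notMem_affineSpan {S : Set (EuclideanSpace ℝ (Fin d))}
    (hS : InGeneralPosition S) {x : EuclideanSpace ℝ (Fin d)}
    (hx : ∀ s : Finset (EuclideanSpace ℝ (Fin d)), ↑s ⊆ S → s.card ≤ d →
      x ∉ affineSpan ℝ (s : Set (EuclideanSpace ℝ (Fin d)))) :
    InGeneralPosition (insert x S) := by
  intro k hk V hV
  by_cases hxV : x ∈ V
  · have h1 : (S ∩ (V : Set _)).encard ≤ (k : ℕ∞) := by
      by_contra! hlt
      have h2 : ((k + 1 : ℕ) : ℕ∞) ≤ (S ∩ (V : Set _)).encard := by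
        push_cast
        exact Order.add_one_le_of_lt hlt
      obtain ⟨t, ht, htc⟩ := Set.exists_subset_encard_eq h2
      have hfin : t.Finite := Set.finite_of_encard_eq_coe htc
      lift t to Finset (EuclideanSpace ℝ (Fin d)) using hfin
      rw [Set.encard_coe_eq_coe_finsetCard, Nat.cast_inj] at htc
      have h3 := hS.le_finrank_vectorSpan (ht.trans Set.inter_subset_left) hk.le htc
      have h4 : affineSpan ℝ (t : Set (EuclideanSpace ℝ (Fin d))) ≤ V :=
        affineSpan_le.2 (ht.trans Set.inter_subset_right)
      have hne : (t : Set (EuclideanSpace ℝ (Fin d))).Nonempty := by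
        rw [Finset.coe_nonempty, ← Finset.card_pos]; omega
      have h5 : affineSpan ℝ (t : Set (EuclideanSpace ℝ (Fin d))) = V := by
        refine AffineSubspace.eq_of_direction_eq_of_nonempty_of_le ?_
          ((affineSpan_nonempty ℝ).2 hne) h4
        refine Submodule.eq_of_le_of_finrank_le (AffineSubspace.direction_le h4) ?_
        rw [direction_affineSpan, hV]
        exact h3
      exact hx t (ht.trans Set.inter_subset_left) (by omega) (h5 ▸ hxV)
    have h2 : insert x S ∩ (V : Set _) ⊆ insert x (S ∩ (V : Set _)) := by
      rintro y ⟨rfl | hy, hyV⟩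
      · exact Set.mem_insert _ _
      · exact Set.mem_insert_of_mem _ ⟨hy, hyV⟩
    refine (Set.encard_le_encard h2).trans ((Set.encard_insert_le _ _).trans ?_)
    push_cast
    gcongr
  · have h2 : insert x S ∩ (V : Set _) ⊆ S ∩ (V : Set _) := by
      rintro y ⟨rfl | hy, hyV⟩
      · exact absurd hyV hxV
      · exact ⟨hy, hyV⟩
    exact (Set.encard_le_encard h2).trans (hS k hk V hV)

/-- The forbidden positions are finitely many proper affine subspaces, a null set, which cannot
cover a ball. -/
theorem InGeneralPosition.exists_insert_near {S : Finset (EuclideanSpace ℝ (Fin d))} (hd : d ≠ 0)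
    (hS : InGeneralPosition (S : Set (EuclideanSpace ℝ (Fin d))))
    (x : EuclideanSpace ℝ (Fin d)) {ε : ℝ} (hε : 0 < ε) :
    ∃ x', ‖x' - x‖ < ε ∧ x' ∉ S ∧
      InGeneralPosition (insert x' (S : Set (EuclideanSpace ℝ (Fin d)))) := by
  let F := S.powerset.filter fun s => s.card ≤ d
  have hnull : volume (⋃ s ∈ F,
      (affineSpan ℝ (s : Set (EuclideanSpace ℝ (Fin d))) : Set (EuclideanSpace ℝ (Fin d)))) = 0 := by
    refine (measure_biUnion_null_iff F.countable_toSet).2 fun s hs => ?_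
    exact Measure.addHaar_affineSubspace _ _
      (affineSpan_ne_top_of_card_le (Finset.mem_filter.1 hs).2)
  have hball : 0 < volume (Metric.ball x ε) := Metric.measure_ball_pos _ _ hε
  obtain ⟨x', hx', hn⟩ : ∃ x' ∈ Metric.ball x ε, x' ∉ ⋃ s ∈ F,
      (affineSpan ℝ (s : Set (EuclideanSpace ℝ (Fin d))) : Set (EuclideanSpace ℝ (Fin d))) := by
    by_contra! hcon
    exact absurd (measure_mono_null hcon hnull) hball.ne'
  have hkey : ∀ s : Finset (EuclideanSpace ℝ (Fin d)), (s : Set (EuclideanSpace ℝ (Fin d))) ⊆ S →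
      s.card ≤ d → x' ∉ affineSpan ℝ (s : Set (EuclideanSpace ℝ (Fin d))) := by
    intro s hs hc hmem
    exact hn (Set.mem_biUnion (Finset.mem_coe.2 (Finset.mem_filter.2
      ⟨Finset.mem_powerset.2 (by exact_mod_cast hs), hc⟩)) hmem)
  refine ⟨x', by rwa [Metric.mem_ball, dist_eq_norm] at hx', fun hxS => ?_,
    hS.insert_of_notMem_affineSpan hkey⟩
  refine hkey {x'} (by simpa using hxS) (by rw [Finset.card_singleton]; omega) ?_
  exact subset_affineSpan ℝ _ (by simp)

/-- A finite family of points can be moved slightly, to be injective and in general position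
together with a given finite set in general position. -/
theorem InGeneralPosition.exists_union_near {ι : Type*} [DecidableEq ι]
    {S : Finset (EuclideanSpace ℝ (Fin d))} (hd : d ≠ 0)
    (hS : InGeneralPosition (S : Set (EuclideanSpace ℝ (Fin d))))
    (π : ι → EuclideanSpace ℝ (Fin d)) {ε : ℝ} (hε : 0 < ε) (G : Finset ι) :
    ∃ π' : ι → EuclideanSpace ℝ (Fin d), (∀ z ∈ G, ‖π' z - π z‖ < ε) ∧ Set.InjOn π' G ∧
      (∀ z ∈ G, π' z ∉ S) ∧
      InGeneralPosition ((S ∪ G.image π' : Finset _) : Set (EuclideanSpace ℝ (Fin d))) := by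
  induction G using Finset.induction_on with
  | empty => exact ⟨π, by simp, by simp, by simp, by simpa using hS⟩
  | insert z G hz ih =>
    obtain ⟨π', h1, h2, h3, h4⟩ := ih
    obtain ⟨x, hx, hxS, hgp⟩ := h4.exists_insert_near hd (π z) hε
    rw [Finset.mem_union, not_or] at hxS
    have hG : ∀ y ∈ G, Function.update π' z x y = π' y := fun y hy =>
      Function.update_of_ne (by rintro rfl; exact hz hy) _ _
    have himg : G.image (Function.update π' z x) = G.image π' := Finset.image_congr hG
    refine ⟨Function.update π' z x, ?_, ?_, ?_, ?_⟩
    · intro y hy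
      rcases Finset.mem_insert.1 hy with rfl | hy
      · simpa using hx
      · rw [hG y hy]; exact h1 y hy
    · rw [Finset.coe_insert, Set.injOn_insert (by simpa using hz)]
      refine ⟨fun a ha b hb hab => ?_, ?_⟩
      · rw [hG a ha, hG b hb] at hab; exact h2 ha hb hab
      · rw [← Finset.coe_image, himg]
        simpa using hxS.2
    · intro y hy
      rcases Finset.mem_insert.1 hy with rfl | hy
      · simpa using hxS.1
      · rw [hG y hy]; exact h3 y hy
    · rw [Finset.image_insert, himg, Function.update_self, Finset.union_insert, Finset.coe_insert]
      exact hgp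

end GeneralPosition

/-! ### Reduction to crowded perturbations of a lattice cube. -/

section Lattice

variable {d : ℕ}

/-- The inclusion of `ℤ^d` in `ℝ^d`. -/
noncomputable def latticePoint (z : Fin d → ℤ) : EuclideanSpace ℝ (Fin d) :=
  WithLp.toLp 2 fun i => (z i : ℝ)

@[simp] theorem latticePoint_apply (z : Fin d → ℤ) (i : Fin d) : latticePoint z i = z i := rfl

/-- The lattice points of the cube `[-R, R]^d`. -/
noncomputable def box (d R : ℕ) : Finset (Fin d → ℤ) := Fintype.piFinset fun _ => Finset.Icc (-(R : ℤ)) R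

theorem mem_box {R : ℕ} {z : Fin d → ℤ} : z ∈ box d R ↔ ∀ i, |z i| ≤ R := by
  simp [box, abs_le]

theorem le_card_box (hd : d ≠ 0) (R : ℕ) : R ≤ (box d R).card := by
  have h : (box d R).card = (2 * R + 1) ^ d := by
    rw [box, Fintype.card_piFinset]
    simp only [Int.card_Icc, Finset.prod_const, Finset.card_univ, Fintype.card_fin]
    congr 1
    omega
  rw [h]
  exact (by omega : R ≤ 2 * R + 1).trans (Nat.le_self_pow hd _)

theorem EuclideanSpace.norm_le_of_forall_abs_le {x : EuclideanSpace ℝ (Fin d)} {b : ℝ}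
    (hb : 0 ≤ b) (h : ∀ i, |x i| ≤ b) : ‖x‖ ≤ d * b := by
  rcases Nat.eq_zero_or_pos d with rfl | hd
  · simp [Subsingleton.elim x 0]
  · have h1 : (1 : ℝ) ≤ d := by exact_mod_cast hd
    rw [EuclideanSpace.norm_eq]
    refine Real.sqrt_le_iff.2 ⟨by positivity, ?_⟩
    calc ∑ i, ‖x i‖ ^ 2 ≤ ∑ _i : Fin d, b ^ 2 :=
          Finset.sum_le_sum fun i _ => pow_le_pow_left₀ (norm_nonneg _) (h i) 2
      _ = d * b ^ 2 := by simp
      _ ≤ (d * b) ^ 2 := by nlinarith [sq_nonneg b]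

theorem exists_box_near (x : EuclideanSpace ℝ (Fin d)) {R : ℕ} (hR : ‖x‖ + 1 ≤ R) :
    ∃ z ∈ box d R, ‖latticePoint z - x‖ ≤ d := by
  have h1 : ∀ i, |(round (x i) : ℝ) - x i| ≤ 1 := fun i => by
    rw [abs_sub_comm]
    exact (abs_sub_round (x i)).trans (by norm_num)
  refine ⟨fun i => round (x i), mem_box.2 fun i => ?_, ?_⟩
  · have h2 : |x i| ≤ ‖x‖ := by simpa using PiLp.norm_apply_le x i
    have h3 : |(round (x i) : ℝ)| ≤ R := by
      have := abs_add_le ((round (x i) : ℝ) - x i) (x i)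
      rw [sub_add_cancel] at this
      linarith [h1 i]
    exact_mod_cast h3
  · have := EuclideanSpace.norm_le_of_forall_abs_le (x := latticePoint (fun i => round (x i)) - x)
      zero_le_one (fun i => by simpa using h1 i)
    simpa using this

theorem Crowded.const_smul {ι E : Type*} [NormedAddCommGroup E] [InnerProductSpace ℝ E] {π : ι → E}
    {G : Finset ι} {c : ℕ} (h : Crowded π G c) {σ : ℝ} (hσ : 0 < σ) :
    Crowded (fun z => σ • π z) G c := by
  intro A hA hc
  obtain ⟨q, hq, hs⟩ := h A hA hc
  refine ⟨q, hq, fun y hy => ?_⟩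
  obtain ⟨a, ha, h'⟩ := hs y hy
  refine ⟨a, ha, ?_⟩
  rw [← smul_sub, real_inner_smul_right]
  exact mul_pos hσ h'

/-- The simplices with vertices in a finite set in general position contain balls of a common
radius. -/
theorem InGeneralPosition.exists_ball_subset {S : Finset (EuclideanSpace ℝ (Fin d))}
    (hS : InGeneralPosition (S : Set (EuclideanSpace ℝ (Fin d)))) :
    ∃ ρ : ℝ, 0 < ρ ∧ ∀ s ⊆ S, s.card = d + 1 → ∃ x, ‖x‖ ≤ ρ⁻¹ ∧
      Metric.ball x ρ ⊆ convexHull ℝ (s : Set (EuclideanSpace ℝ (Fin d))) := by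
  have key : ∀ s ∈ S.powersetCard (d + 1), ∀ᶠ ρ in nhdsWithin (0 : ℝ) (Set.Ioi 0),
      ∃ x, ‖x‖ ≤ ρ⁻¹ ∧ Metric.ball x ρ ⊆ convexHull ℝ (s : Set (EuclideanSpace ℝ (Fin d))) := by
    intro s hs
    obtain ⟨h1, h2⟩ := Finset.mem_powersetCard.1 hs
    obtain ⟨x, hx⟩ := interior_convexHull_nonempty_iff_affineSpan_eq_top.2
      (hS.affineSpan_eq_top (by exact_mod_cast h1) h2)
    obtain ⟨ρ, hρ, hb⟩ := Metric.isOpen_iff.1 isOpen_interior x hx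
    have h3 : (0 : ℝ) < min ρ (‖x‖ + 1)⁻¹ := lt_min hρ (by positivity)
    filter_upwards [Ioo_mem_nhdsGT h3] with r hr
    obtain ⟨hr1, hr2⟩ := lt_min_iff.1 hr.2
    refine ⟨x, ?_, (Metric.ball_subset_ball hr1.le).trans (hb.trans interior_subset)⟩
    rw [lt_inv_comm₀ hr.1 (by positivity)] at hr2
    linarith
  obtain ⟨ρ, h1, h2⟩ := (((Finset.eventually_all _).2 key).and self_mem_nhdsWithin).exists
  exact ⟨ρ, h2, fun s hs hc => h1 s (Finset.mem_powersetCard.2 ⟨hs, hc⟩)⟩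

theorem exists_holeFree_superset {c : ℕ} (hd : d ≠ 0)
    (H : ∀ R : ℕ, ∃ π : (Fin d → ℤ) → EuclideanSpace ℝ (Fin d),
      (∀ z ∈ box d R, ‖π z - latticePoint z‖ ≤ 1) ∧ Crowded π (box d R) c)
    (S : Finset (EuclideanSpace ℝ (Fin d)))
    (hS : InGeneralPosition (S : Set (EuclideanSpace ℝ (Fin d)))) (n : ℕ) :
    ∃ T : Finset (EuclideanSpace ℝ (Fin d)), S ⊆ T ∧ n ≤ T.card ∧
      InGeneralPosition (T : Set (EuclideanSpace ℝ (Fin d))) ∧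
      HoleFree (c + d) (T : Set (EuclideanSpace ℝ (Fin d))) := by
  classical
  have : Nonempty (Fin d) := ⟨⟨0, Nat.pos_of_ne_zero hd⟩⟩
  obtain ⟨ρ, hρ, hball⟩ := hS.exists_ball_subset
  -- The mesh: rounding to the lattice costs at most `d * σ`, the perturbation `π` at most `σ`, and
  -- the move to general position less than `σ`, in total less than the radius `ρ`.
  set σ : ℝ := ρ / (d + 2) with hσdef
  have hσ : 0 < σ := by positivity
  -- The first bound provides enough points; the second makes the scaled cube reach the centres of
  -- all the balls, with a margin for rounding.
  obtain ⟨R, hR⟩ := exists_nat_ge (max (n : ℝ) (σ⁻¹ * ρ⁻¹ + 1))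
  obtain ⟨π, hπ, hcr⟩ := H R
  obtain ⟨ε, hε, hnear⟩ := (hcr.const_smul hσ).of_near
  obtain ⟨π', h1, h2, h3, h4⟩ := hS.exists_union_near hd (fun z => σ • π z)
    (lt_min hε hσ) (box d R)
  have hcr' := hnear π' fun z hz => (h1 z hz).trans_le (min_le_left _ _)
  refine ⟨S ∪ (box d R).image π', Finset.subset_union_left, ?_, h4, ?_⟩
  · calc n ≤ R := by exact_mod_cast (le_max_left _ _).trans hR
      _ ≤ (box d R).card := le_card_box hd R
      _ = ((box d R).image π').card := (Finset.card_image_of_injOn h2).symm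
      _ ≤ _ := Finset.card_le_card Finset.subset_union_right
  · intro A hA hcard
    have hAT : A ⊆ S ∪ (box d R).image π' := by exact_mod_cast hA
    by_cases hAS : d + 1 ≤ (A ∩ S).card
    · obtain ⟨s, hs, hsc⟩ := Finset.exists_subset_card_eq hAS
      obtain ⟨x, hx, hxb⟩ := hball s (hs.trans Finset.inter_subset_right) hsc
      have hR' : ‖σ⁻¹ • x‖ + 1 ≤ R := by
        rw [norm_smul, Real.norm_of_nonneg (inv_nonneg.2 hσ.le)]
        have := mul_le_mul_of_nonneg_left hx (inv_nonneg.2 hσ.le)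
        linarith [(le_max_right _ _).trans hR]
      obtain ⟨z, hz, hzx⟩ := exists_box_near (σ⁻¹ • x) hR'
      refine ⟨π' z, ?_, ?_⟩
      · exact Finset.mem_coe.2 (Finset.mem_union_right _ (Finset.mem_image_of_mem _ hz))
      · refine interior_mono (convexHull_mono (Finset.coe_subset.2
          (hs.trans Finset.inter_subset_left))) (_root_.mem_interior.2
          ⟨Metric.ball x ρ, hxb, Metric.isOpen_ball, ?_⟩)
        rw [Metric.mem_ball, dist_eq_norm]
        have e : π' z - x = (π' z - σ • π z) + σ • ((π z - latticePoint z) +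
            (latticePoint z - σ⁻¹ • x)) := by
          rw [sub_add_sub_cancel, smul_sub, smul_inv_smul₀ hσ.ne']; abel
        rw [e]
        calc _ ≤ ‖π' z - σ • π z‖ + ‖σ • ((π z - latticePoint z) +
            (latticePoint z - σ⁻¹ • x))‖ := norm_add_le _ _
          _ < σ + σ * (1 + d) := by
            refine add_lt_add_of_lt_of_le ((h1 z hz).trans_le (min_le_right _ _)) ?_
            rw [norm_smul, Real.norm_of_nonneg hσ.le]
            gcongr
            exact (norm_add_le _ _).trans (add_le_add (hπ z hz) hzx)
          _ = ρ := by rw [hσdef]; field_simp; ring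
    · have hc : c ≤ (A \ S).card := by
        have := Finset.card_inter_add_card_sdiff A S
        omega
      have himg : A \ S ⊆ ((box d R).filter fun z => π' z ∈ A).image π' := by
        intro a ha
        obtain ⟨haA, haS⟩ := Finset.mem_sdiff.1 ha
        obtain ⟨z, hz, rfl⟩ := Finset.mem_image.1
          ((Finset.mem_union.1 (hAT haA)).resolve_left haS)
        exact Finset.mem_image_of_mem _ (Finset.mem_filter.2 ⟨hz, haA⟩)
      obtain ⟨B, hB, hBc⟩ := Finset.exists_subset_card_eq
        (hc.trans ((Finset.card_le_card himg).trans Finset.card_image_le))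
      obtain ⟨q, hq, hs⟩ := hcr' B (hB.trans (Finset.filter_subset _ _)) hBc
      refine ⟨π' q, ?_, interior_mono (convexHull_mono ?_) hs.mem_interior⟩
      · exact Finset.mem_coe.2 (Finset.mem_union_right _ (Finset.mem_image_of_mem _ hq))
      · rintro _ ⟨b, hb, rfl⟩
        exact (Finset.mem_filter.1 (hB hb)).2

end Lattice

/-! ### Heights that tilt relations in a given direction. -/

section Perturbation

variable {ι E : Type*} [NormedAddCommGroup E] [InnerProductSpace ℝ E]

/-- Take `w 0` plus a tiny multiple of the height built from the later ranks: a difference at one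
level then dominates, by the factor `1 / κ`, all differences that begin at a later level. -/
theorem exists_lexicographic_height (G : Finset ι) (J : ℕ) (w : ℕ → ι → ℕ) {κ : ℝ} (hκ : 0 < κ) :
    ∃ h : ι → ℝ, ∀ j < J, ∀ u ∈ G, ∀ q ∈ G, (∀ l < j, w l u = w l q) →
      (w j u < w j q → h u < h q) ∧
      (w j u ≠ w j q → ∀ x ∈ G, (∀ l ≤ j, w l x = w l q) → |h x - h q| ≤ κ * |h u - h q|) := by
  induction J generalizing w with
  | zero => exact ⟨0, fun j hj => absurd hj (Nat.not_lt_zero j)⟩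
  | succ J ih =>
    obtain ⟨h, hh⟩ := ih (fun l => w (l + 1))
    obtain ⟨M, hM⟩ : ∃ M : ℝ, ∀ x ∈ G, |h x| ≤ M := by
      obtain ⟨M, hM⟩ := (G.image fun x => |h x|).bddAbove
      exact ⟨M, fun x hx => hM (Finset.mem_coe.2 (Finset.mem_image_of_mem _ hx))⟩
    have hM' : ∀ x ∈ G, ∀ y ∈ G, |h x - h y| ≤ 2 * |M| := fun x hx y hy => by
      have := abs_sub (h x) (h y)
      linarith [hM x hx, hM y hy, le_abs_self M]
    -- Later levels contribute at most `min 1 κ / 2`. Distinct values of `w 0` differ by at least 1,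
    -- so their gap stays at least `1 / 2`.
    set η : ℝ := min 1 κ / (4 * (|M| + 1)) with hηdef
    have hη : 0 < η := by positivity
    have hη1 : η * (2 * |M|) ≤ min 1 κ / 2 := by
      have h0 : 0 < min 1 κ := lt_min one_pos hκ
      rw [hηdef, div_mul_eq_mul_div, div_le_div_iff₀ (by positivity) (by positivity)]
      nlinarith [abs_nonneg M]
    have hsmall : ∀ x ∈ G, ∀ y ∈ G, |η * (h x - h y)| ≤ min 1 κ / 2 := fun x hx y hy => by
      rw [abs_mul, abs_of_pos hη]
      exact (mul_le_mul_of_nonneg_left (hM' x hx y hy) hη.le).trans hη1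
    refine ⟨fun x => w 0 x + η * h x, fun j hj u hu q hq hl => ?_⟩
    have hdiff : ∀ x, (w 0 x + η * h x) - (w 0 q + η * h q) =
        ((w 0 x : ℝ) - w 0 q) + η * (h x - h q) := fun x => by ring
    rcases j with _ | j
    · have hb := abs_le.1 (hsmall u hu q hq)
      have h1 : min 1 κ ≤ 1 := min_le_left _ _
      refine ⟨fun hlt => ?_, fun hne x hx hxq => ?_⟩
      · have h2 : (w 0 u : ℝ) + 1 ≤ w 0 q := by exact_mod_cast hlt
        have := hdiff u
        simp only
        linarith
      · rw [hdiff, hdiff, hxq 0 le_rfl, sub_self, zero_add]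
        refine (hsmall x hx q hq).trans ?_
        have h3 : (1 : ℝ) ≤ |(w 0 u : ℝ) - w 0 q| := by
          rcases Nat.lt_or_gt_of_ne hne with hlt | hlt
          · have h2 : (w 0 u : ℝ) + 1 ≤ w 0 q := by exact_mod_cast hlt
            rw [abs_sub_comm]
            exact le_trans (by linarith) (le_abs_self _)
          · have h2 : (w 0 q : ℝ) + 1 ≤ w 0 u := by exact_mod_cast hlt
            exact le_trans (by linarith) (le_abs_self _)
        have h4 : 1 / 2 ≤ |((w 0 u : ℝ) - w 0 q) + η * (h u - h q)| := by
          have := abs_sub_abs_le_abs_add ((w 0 u : ℝ) - w 0 q) (η * (h u - h q))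
          linarith [hsmall u hu q hq]
        calc min 1 κ / 2 ≤ κ * (1 / 2) := by linarith [min_le_right 1 κ]
          _ ≤ _ := by gcongr
    · have h0 : w 0 u = w 0 q := hl 0 (Nat.succ_pos j)
      obtain ⟨ha, hb⟩ := hh j (by omega) u hu q hq fun l hlj => hl (l + 1) (by omega)
      refine ⟨fun hlt => ?_, fun hne x hx hxq => ?_⟩
      · have := mul_lt_mul_of_pos_left (ha hlt) hη
        simp only [h0]
        linarith
      · rw [hdiff, hdiff, h0, hxq 0 (Nat.zero_le _), sub_self, zero_add, zero_add, abs_mul, abs_mul,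
          abs_of_pos hη]
        have := mul_le_mul_of_nonneg_left
          (hb hne x hx fun l hlj => hxq (l + 1) (by omega)) hη.le
        linarith

theorem exists_small_lexicographic_height (G : Finset ι) (J : ℕ) (w : ℕ → ι → ℕ) {κ δ : ℝ}
    (hκ : 0 < κ) (hδ : 0 < δ) :
    ∃ h : ι → ℝ, (∀ x ∈ G, |h x| ≤ δ) ∧
      ∀ j < J, ∀ u ∈ G, ∀ q ∈ G, (∀ l < j, w l u = w l q) →
      (w j u < w j q → h u < h q) ∧
      (w j u ≠ w j q → ∀ x ∈ G, (∀ l ≤ j, w l x = w l q) → |h x - h q| ≤ κ * |h u - h q|) := by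
  obtain ⟨h, hh⟩ := exists_lexicographic_height G J w hκ
  obtain ⟨M, hM⟩ : ∃ M : ℝ, ∀ x ∈ G, |h x| ≤ M := by
    obtain ⟨M, hM⟩ := (G.image fun x => |h x|).bddAbove
    exact ⟨M, fun x hx => hM (Finset.mem_coe.2 (Finset.mem_image_of_mem _ hx))⟩
  have hs : 0 < δ / (|M| + 1) := by positivity
  refine ⟨fun x => δ / (|M| + 1) * h x, fun x hx => ?_, fun j hj u hu q hq hl => ?_⟩
  · rw [abs_mul, abs_of_pos hs, div_mul_eq_mul_div, div_le_iff₀ (by positivity)]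
    exact mul_le_mul_of_nonneg_left (by linarith [hM x hx, le_abs_self M]) hδ.le
  · obtain ⟨ha, hb⟩ := hh j hj u hu q hq hl
    refine ⟨fun hlt => mul_lt_mul_of_pos_left (ha hlt) hs, fun hne x hx hxq => ?_⟩
    rw [← mul_sub, ← mul_sub, abs_mul, abs_mul, abs_of_pos hs]
    have := mul_le_mul_of_nonneg_left (hb hne x hx hxq) hs.le
    linarith

/-- In the lexicographic order given by the ranks `w`, some point of `B` is below `q`, at a level at
which `C` is not above `q`. -/
def SeparatesBelow (w : ℕ → ι → ℕ) (C B : Finset ι) (q : ι) : Prop :=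
  ∃ j, ∃ u ∈ B, (∀ l < j, w l u = w l q) ∧ w j u < w j q ∧
    ∀ a ∈ C, (∀ l < j, w l a = w l q) ∧ w j a ≤ w j q

/-- In the lexicographic order given by the ranks `w`, some point of `B` is above `q`, at a level at
which `C` is not below `q`. -/
def SeparatesAbove (w : ℕ → ι → ℕ) (C B : Finset ι) (q : ι) : Prop :=
  ∃ j, ∃ u ∈ B, (∀ l < j, w l u = w l q) ∧ w j q < w j u ∧
    ∀ a ∈ C, (∀ l < j, w l a = w l q) ∧ w j q ≤ w j a

/-- Both `SeparatesBelow` and `SeparatesAbove`. -/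
def Separates (w : ℕ → ι → ℕ) (C B : Finset ι) (q : ι) : Prop :=
  SeparatesBelow w C B q ∧ SeparatesAbove w C B q

theorem Separates.anti {w : ℕ → ι → ℕ} {C C' B : Finset ι} {q : ι} (h : Separates w C B q)
    (hC : C' ⊆ C) : Separates w C' B q := by
  obtain ⟨⟨j, u, hu, h1, h2, h3⟩, ⟨j', u', hu', h1', h2', h3'⟩⟩ := h
  exact ⟨⟨j, u, hu, h1, h2, fun a ha => h3 a (hC ha)⟩,
    ⟨j', u', hu', h1', h2', fun a ha => h3' a (hC ha)⟩⟩

/-- A positive relation among the vectors `π a - π q`, `a ∈ C`, whose total height is of the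
sign of `σ`. -/
def TiltedAt (σ : ℝ) (h : ι → ℝ) (π : ι → E) (C : Finset ι) (q : ι) : Prop :=
  ∃ t : ι → ℝ, (∀ a ∈ C, 0 < t a) ∧ ∑ a ∈ C, t a • (π a - π q) = 0 ∧
    0 < σ * ∑ a ∈ C, t a * (h a - h q)

theorem sum_smul_sub_eq_smul {π : ι → E} {C : Finset ι} {q : ι} {t : ι → ℝ} (h : ι → ℝ) (v : E)
    (ht : ∑ a ∈ C, t a • (π a - π q) = 0) :
    ∑ a ∈ C, t a • ((π a + h a • v) - (π q + h q • v)) = (∑ a ∈ C, t a * (h a - h q)) • v := by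
  have hdiff : ∀ a, (π a + h a • v) - (π q + h q • v) = (π a - π q) + (h a - h q) • v := fun a => by
    rw [sub_smul]; abel
  simp only [hdiff, smul_add, Finset.sum_add_distrib, ht, zero_add, Finset.sum_smul, mul_smul]

variable [DecidableEq ι]

theorem sum_insert_ite_smul {M : Type*} [AddCommGroup M] [Module ℝ M] (C : Finset ι) (u : ι)
    (τ : ι → ℝ) (f : ι → M) :
    ∑ a ∈ insert u C, ((if a ∈ C then τ a else 0) + if a = u then 1 else 0) • f a =
      ∑ a ∈ C, τ a • f a + f u := by
  simp only [add_smul, Finset.sum_add_distrib, ite_smul, zero_smul, one_smul]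
  congr 1
  · rw [← Finset.sum_filter]
    congr 1
    ext a
    simp only [Finset.mem_filter, Finset.mem_insert]
    tauto
  · simp

/-- A positive relation on `insert u C` whose total height is negative. -/
theorem BalancedAt.exists_relation {π : ι → E} {C : Finset ι} {q u : ι} (hC : BalancedAt π C q)
    (hu : π u - π q ∈ spread π C q) :
    ∀ᶠ κ in nhdsWithin (0 : ℝ) (Set.Ioi 0), ∀ h : ι → ℝ, h u < h q →
      (∀ a ∈ C, h a - h q ≤ κ * (h q - h u)) →
      ∃ t : ι → ℝ, (∀ a ∈ insert u C, 0 < t a) ∧ ∑ a ∈ insert u C, t a • (π a - π q) = 0 ∧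
        ∑ a ∈ insert u C, t a * (h a - h q) < 0 := by
  obtain ⟨t₀, ht₀, hsum₀⟩ := hC
  obtain ⟨c, hc⟩ : ∃ c : ι → ℝ, ∑ a ∈ C, c a • (π a - π q) = π u - π q :=
    (Submodule.mem_span_image_finset_iff_exists_fun' ℝ).1 hu
  -- Subtracting the expansion of `π u - π q` from a large multiple of the given relation keeps all
  -- coefficients positive and brings in `u` with coefficient 1.
  obtain ⟨s, hs⟩ : ∃ s : ℝ, ∀ a ∈ C, 0 < s * t₀ a - c a := by
    have : ∀ a ∈ C, ∀ᶠ s in Filter.atTop, 0 < s * t₀ a - c a := fun a ha => by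
      filter_upwards [Filter.eventually_gt_atTop (c a / t₀ a)] with s hs
      rw [div_lt_iff₀ (ht₀ a ha)] at hs
      linarith
    exact ((Finset.eventually_all C).2 this).exists
  set τ : ι → ℝ := fun a => s * t₀ a - c a
  have hrel : ∑ a ∈ C, τ a • (π a - π q) + (π u - π q) = 0 := by
    simp only [τ, sub_smul, mul_smul, Finset.sum_sub_distrib, ← Finset.smul_sum, hsum₀, hc]
    simp
  have hτ : 0 ≤ ∑ a ∈ C, τ a := Finset.sum_nonneg fun a ha => (hs a ha).le
  -- With `κ` below this bound, the drop at `u` outweighs whatever `C` contributes. The bound does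
  -- not depend on `h`, so `κ` can be fixed before the height is built.
  have hκ₀ : 0 < (∑ a ∈ C, τ a + 1)⁻¹ := by positivity
  filter_upwards [Ioo_mem_nhdsGT hκ₀] with κ hκ h hlt hh
  refine ⟨fun a => (if a ∈ C then τ a else 0) + if a = u then 1 else 0, fun a ha => ?_, ?_, ?_⟩
  · by_cases haC : a ∈ C
    · have := hs a haC
      have h2 : (0 : ℝ) ≤ if a = u then 1 else 0 := by split_ifs <;> norm_num
      simp only [haC, if_true]
      linarith
    · have hau : a = u := by simpa [haC] using ha
      simp [hau ▸ haC, hau]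
  · rw [sum_insert_ite_smul C u τ fun a => π a - π q, hrel]
  · have h1 := sum_insert_ite_smul C u τ fun a => h a - h q
    simp only [smul_eq_mul] at h1
    rw [h1]
    have h2 : ∑ a ∈ C, τ a * (h a - h q) ≤ (∑ a ∈ C, τ a) * (κ * (h q - h u)) := by
      rw [Finset.sum_mul]
      exact Finset.sum_le_sum fun a ha => mul_le_mul_of_nonneg_left (hh a ha) (hs a ha).le
    have h3 : (∑ a ∈ C, τ a) * κ < 1 := by
      have := hκ.2
      rw [lt_inv_comm₀ hκ.1 (by positivity)] at this
      have h4 : (∑ a ∈ C, τ a + 1) * κ < 1 := by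
        have := mul_lt_mul_of_pos_right this hκ.1
        rwa [inv_mul_cancel₀ hκ.1.ne'] at this
      nlinarith [hκ.1]
    have h5 : (∑ a ∈ C, τ a) * κ * (h q - h u) < 1 * (h q - h u) :=
      mul_lt_mul_of_pos_right h3 (by linarith)
    linarith

/-- After the move the two relations sum to a negative and a positive multiple of `v`. Either one
puts `v` in the spread, and weighting them to cancel gives a positive relation on the union. -/
theorem TiltedAt.balancedAt {π : ι → E} {C₁ C₂ : Finset ι} {q : ι} {h : ι → ℝ} (v : E)
    (H₁ : TiltedAt (-1) h π C₁ q) (H₂ : TiltedAt 1 h π C₂ q) :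
    BalancedAt (fun x => π x + h x • v) (C₁ ∪ C₂) q ∧
      v ∈ spread (fun x => π x + h x • v) (C₁ ∪ C₂) q ∧
      spread π (C₁ ∪ C₂) q ≤ spread (fun x => π x + h x • v) (C₁ ∪ C₂) q := by
  obtain ⟨t₁, ht₁, hs₁, hh₁⟩ := H₁
  obtain ⟨t₂, ht₂, hs₂, hh₂⟩ := H₂
  rw [neg_one_mul, neg_pos] at hh₁
  rw [one_mul] at hh₂
  set π' : ι → E := fun x => π x + h x • v with hπ'
  have hdiff : ∀ a, π' a - π' q = (π a - π q) + (h a - h q) • v := fun a => by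
    simp only [hπ', sub_smul]; abel
  have h1 : ∑ a ∈ C₁, t₁ a • (π' a - π' q) = _ := sum_smul_sub_eq_smul h v hs₁
  have h2 : ∑ a ∈ C₂, t₂ a • (π' a - π' q) = _ := sum_smul_sub_eq_smul h v hs₂
  set x₁ := ∑ a ∈ C₁, t₁ a * (h a - h q)
  set x₂ := ∑ a ∈ C₂, t₂ a * (h a - h q)
  have hv : v ∈ spread π' (C₁ ∪ C₂) q := by
    refine (Submodule.smul_mem_iff _ hh₁.ne).1 (h1 ▸ Submodule.sum_mem _ fun a ha => ?_)
    exact Submodule.smul_mem _ _ (sub_mem_spread (Finset.mem_union_left _ ha))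
  refine ⟨⟨fun a => (if a ∈ C₁ then x₂ * t₁ a else 0) + if a ∈ C₂ then (-x₁) * t₂ a else 0,
    fun a ha => ?_, ?_⟩, hv, Submodule.span_le.2 ?_⟩
  · have p₁ : a ∈ C₁ → 0 < x₂ * t₁ a := fun h => mul_pos hh₂ (ht₁ a h)
    have p₂ : a ∈ C₂ → 0 < (-x₁) * t₂ a := fun h => mul_pos (neg_pos.2 hh₁) (ht₂ a h)
    by_cases a₁ : a ∈ C₁ <;> by_cases a₂ : a ∈ C₂
    · simp only [a₁, a₂, if_true]; exact add_pos (p₁ a₁) (p₂ a₂)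
    · simpa only [a₁, a₂, if_true, if_false, add_zero] using p₁ a₁
    · simpa only [a₁, a₂, if_true, if_false, zero_add] using p₂ a₂
    · exact absurd ha (by simp [a₁, a₂])
  · simp only [add_smul, Finset.sum_add_distrib, ite_smul, zero_smul]
    rw [← Finset.sum_filter, ← Finset.sum_filter, Finset.filter_mem_eq_inter,
      Finset.filter_mem_eq_inter, Finset.union_inter_cancel_left, Finset.union_inter_cancel_right]
    simp only [mul_smul, ← Finset.smul_sum, h1, h2]
    rw [← mul_smul, ← mul_smul, ← add_smul, mul_comm, neg_mul, add_neg_cancel, zero_smul]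
  · rintro _ ⟨a, ha, rfl⟩
    have := Submodule.sub_mem _ (sub_mem_spread (π := π') (q := q) ha)
      (Submodule.smul_mem _ (h a - h q) hv)
    rwa [hdiff, add_sub_cancel_right] at this

/-- One `κ` serves all the finitely many triples `C`, `q`, `u`. Separation makes each point of `C`
either lie on the same side of `q` as `u` or agree with `q` to a deeper level, where its height
difference is negligible. -/
theorem exists_tilting_height (G : Finset ι) (π : ι → E) (w : ℕ → ι → ℕ) {δ : ℝ} (hδ : 0 < δ)
    {J : ℕ} (hJ : ∀ j, ∀ x ∈ G, ∀ y ∈ G, (∀ l < j, w l x = w l y) → w j x ≠ w j y → j < J) :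
    ∃ h : ι → ℝ, (∀ x ∈ G, |h x| ≤ δ) ∧ ∀ C ⊆ G, ∀ B ⊆ G, ∀ q ∈ G, BalancedAt π C q →
      (∀ u ∈ B, π u - π q ∈ spread π C q) →
      (SeparatesBelow w C B q → ∃ u ∈ B, TiltedAt (-1) h π (insert u C) q) ∧
      (SeparatesAbove w C B q → ∃ u ∈ B, TiltedAt 1 h π (insert u C) q) := by
  have key : ∀ C ∈ G.powerset, ∀ q ∈ G, ∀ u ∈ G, ∀ᶠ κ in nhdsWithin (0 : ℝ) (Set.Ioi 0),
      BalancedAt π C q → π u - π q ∈ spread π C q → ∀ h : ι → ℝ, h u < h q →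
      (∀ a ∈ C, h a - h q ≤ κ * (h q - h u)) →
      ∃ t : ι → ℝ, (∀ a ∈ insert u C, 0 < t a) ∧ ∑ a ∈ insert u C, t a • (π a - π q) = 0 ∧
        ∑ a ∈ insert u C, t a * (h a - h q) < 0 := by
    intro C _ q _ u _
    by_cases hC : BalancedAt π C q
    · by_cases hu : π u - π q ∈ spread π C q
      · filter_upwards [hC.exists_relation hu] with κ hκ _ _ using hκ
      · simp [hu]
    · simp [hC]
  obtain ⟨κ, hκ, hκ₀⟩ := (((Finset.eventually_all _).2 fun C hC => (Finset.eventually_all _).2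
    fun q hq => (Finset.eventually_all _).2 fun u hu => key C hC q hq u hu).and
    self_mem_nhdsWithin).exists
  obtain ⟨h, hsmall, hh⟩ := exists_small_lexicographic_height G J w hκ₀ hδ
  refine ⟨h, hsmall, fun C hC B hB q hq hbal hspread => ⟨?_, ?_⟩⟩
  · rintro ⟨j, u, hu, h1, h2, h3⟩
    have hj := hJ j u (hB hu) q hq h1 h2.ne
    have hu₁ := hh j hj u (hB hu) q hq h1
    have hlt := hu₁.1 h2
    obtain ⟨t, ht, hs, hn⟩ := hκ C (Finset.mem_powerset.2 hC) q hq u (hB hu) hbal (hspread u hu) h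
      hlt fun a ha => by
        rcases (h3 a ha).2.lt_or_eq with hlt2 | heq
        · have := (hh j hj a (hC ha) q hq (h3 a ha).1).1 hlt2
          have := mul_pos hκ₀ (sub_pos.2 hlt)
          linarith
        · have := hu₁.2 h2.ne a (hC ha) fun l hl => hl.lt_or_eq.elim ((h3 a ha).1 l) (· ▸ heq)
          rw [abs_sub_comm (h u), abs_of_pos (sub_pos.2 hlt)] at this
          exact (le_abs_self _).trans this
    exact ⟨u, hu, t, ht, hs, by linarith⟩
  · rintro ⟨j, u, hu, h1, h2, h3⟩
    have hj := hJ j u (hB hu) q hq h1 h2.ne'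
    have hu₂ := hh j hj u (hB hu) q hq h1
    have hlt := (hh j hj q hq u (hB hu) fun l hl => (h1 l hl).symm).1 h2
    obtain ⟨t, ht, hs, hn⟩ := hκ C (Finset.mem_powerset.2 hC) q hq u (hB hu) hbal (hspread u hu)
      -- The case above is the case below for the opposite height.
      (fun x => -h x) (neg_lt_neg hlt) fun a ha => by
        rcases (h3 a ha).2.lt_or_eq with hlt2 | heq
        · have := (hh j hj q hq a (hC ha) fun l hl => ((h3 a ha).1 l hl).symm).1 hlt2
          have := mul_pos hκ₀ (sub_pos.2 hlt)
          linarith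
        · have := hu₂.2 h2.ne' a (hC ha) fun l hl =>
            hl.lt_or_eq.elim ((h3 a ha).1 l) (· ▸ heq.symm)
          rw [abs_of_pos (sub_pos.2 hlt)] at this
          have h5 := (neg_le_abs _).trans this
          linarith
    refine ⟨u, hu, t, ht, hs, ?_⟩
    have : ∑ a ∈ insert u C, t a * (-h a - -h q) = -∑ a ∈ insert u C, t a * (h a - h q) := by
      rw [← Finset.sum_neg_distrib]
      exact Finset.sum_congr rfl fun a _ => by ring
    linarith

/-- A height that makes `v` available in the spread of every separated balanced family, after
moving each point by the corresponding multiple of `v`. -/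
theorem exists_height (G : Finset ι) (π : ι → E) (w : ℕ → ι → ℕ) (v : E) {δ : ℝ} (hδ : 0 < δ)
    {J : ℕ} (hJ : ∀ j, ∀ x ∈ G, ∀ y ∈ G, (∀ l < j, w l x = w l y) → w j x ≠ w j y → j < J) :
    ∃ h : ι → ℝ, (∀ x ∈ G, |h x| ≤ δ) ∧ ∀ C ⊆ G, ∀ B ⊆ G, ∀ q ∈ G, BalancedAt π C q →
      (∀ u ∈ B, π u - π q ∈ spread π C q) → Separates w C B q →
      ∃ C' ⊆ C ∪ B, BalancedAt (fun x => π x + h x • v) C' q ∧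
        v ∈ spread (fun x => π x + h x • v) C' q ∧
        spread π C q ≤ spread (fun x => π x + h x • v) C' q := by
  obtain ⟨h, hsmall, hh⟩ := exists_tilting_height G π w hδ hJ
  refine ⟨h, hsmall, fun C hC B hB q hq hbal hspread hsep => ?_⟩
  obtain ⟨u₁, hu₁, H₁⟩ := (hh C hC B hB q hq hbal hspread).1 hsep.1
  obtain ⟨u₂, hu₂, H₂⟩ := (hh C hC B hB q hq hbal hspread).2 hsep.2
  obtain ⟨b1, b2, b3⟩ := H₁.balancedAt v H₂
  refine ⟨insert u₁ C ∪ insert u₂ C, ?_, b1, b2, (spread_mono ?_).trans b3⟩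
  · exact Finset.union_subset (Finset.insert_subset (Finset.mem_union_right _ hu₁)
      Finset.subset_union_left) (Finset.insert_subset (Finset.mem_union_right _ hu₂)
      Finset.subset_union_left)
  · exact (Finset.subset_insert _ _).trans Finset.subset_union_left

end Perturbation

/-! ### Residue classes modulo prime powers and separation. -/

section Residues

variable {d : ℕ}

/-- Coordinatewise reduction modulo `m`. -/
def reduce (m : ℕ) (z : Fin d → ℤ) : Fin d → ZMod m := fun i => z i

theorem reduce_eq_iff {m : ℕ} {x y : Fin d → ℤ} :
    reduce m x = reduce m y ↔ ∀ i, (m : ℤ) ∣ x i - y i := by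
  simp only [reduce, funext_iff]
  refine forall_congr' fun i => ?_
  rw [eq_comm, ZMod.intCast_eq_intCast_iff_dvd_sub]

theorem reduce_eq_of_dvd {m n : ℕ} (h : m ∣ n) {x y : Fin d → ℤ}
    (hxy : reduce n x = reduce n y) : reduce m x = reduce m y :=
  reduce_eq_iff.2 fun i => (Int.natCast_dvd_natCast.2 h).trans (reduce_eq_iff.1 hxy i)

theorem reduce_pow_eq_of_le {p j k : ℕ} (h : j ≤ k) {x y : Fin d → ℤ}
    (hxy : reduce (p ^ k) x = reduce (p ^ k) y) : reduce (p ^ j) x = reduce (p ^ j) y :=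
  reduce_eq_of_dvd (pow_dvd_pow p h) hxy

theorem reduce_one_eq (x y : Fin d → ℤ) : reduce 1 x = reduce 1 y :=
  reduce_eq_iff.2 fun i => by simp

instance (n : ℕ) : Countable (ZMod n) := (ZMod.intCast_surjective (n := n)).countable

/-- An injective numbering of the residue classes modulo `p ^ (j + 1)`. -/
noncomputable def rank (p j : ℕ) (z : Fin d → ℤ) : ℕ :=
  (Countable.exists_injective_nat (Fin d → ZMod (p ^ (j + 1)))).choose (reduce (p ^ (j + 1)) z)

theorem rank_eq_iff {p j : ℕ} {x y : Fin d → ℤ} :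
    rank p j x = rank p j y ↔ reduce (p ^ (j + 1)) x = reduce (p ^ (j + 1)) y :=
  (Countable.exists_injective_nat (Fin d → ZMod (p ^ (j + 1)))).choose_spec.eq_iff

theorem rank_eq_of_reduce_eq {p j l : ℕ} (hl : l < j) {x y : Fin d → ℤ}
    (h : reduce (p ^ j) x = reduce (p ^ j) y) : rank p l x = rank p l y :=
  rank_eq_iff.2 (reduce_pow_eq_of_le hl h)

theorem reduce_eq_of_rank_eq {p j : ℕ} {x y : Fin d → ℤ} (h : ∀ l < j, rank p l x = rank p l y) :
    reduce (p ^ j) x = reduce (p ^ j) y := by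
  rcases j with _ | j
  · rw [pow_zero]; exact reduce_one_eq x y
  · exact rank_eq_iff.1 (h j j.lt_succ_self)

theorem lt_of_reduce_eq {p R j : ℕ} (hp : 2 ≤ p) {x y : Fin d → ℤ} (hx : x ∈ box d R)
    (hy : y ∈ box d R) (hxy : x ≠ y) (h : reduce (p ^ j) x = reduce (p ^ j) y) : j < 2 * R + 1 := by
  obtain ⟨i, hi⟩ := Function.ne_iff.1 hxy
  have h1 := Int.le_of_dvd (abs_pos.2 (sub_ne_zero.2 hi)) ((dvd_abs _ _).2 (reduce_eq_iff.1 h i))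
  have h2 := abs_sub (x i) (y i)
  have h3 := mem_box.1 hx i
  have h4 := mem_box.1 hy i
  have h5 : j < p ^ j := Nat.lt_pow_self hp
  zify at h5 ⊢
  push_cast at h1
  linarith

/-- Distinct points of the cube are incongruent modulo large powers, so only finitely many levels
matter for the height. -/
theorem lt_of_rank_ne {p R : ℕ} (hp : 2 ≤ p) : ∀ j, ∀ x ∈ box d R, ∀ y ∈ box d R,
    (∀ l < j, rank p l x = rank p l y) → rank p j x ≠ rank p j y → j < 2 * R + 1 :=
  fun _ _ hx _ hy h hne =>
    lt_of_reduce_eq hp hx hy (by rintro rfl; exact hne rfl) (reduce_eq_of_rank_eq h)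

theorem exists_subset_box (A : Finset (Fin d → ℤ)) : ∃ R, A ⊆ box d R := by
  obtain ⟨R, hR⟩ := (A.image fun z => ∑ i, (z i).natAbs).bddAbove
  refine ⟨R, fun z hz => mem_box.2 fun i => ?_⟩
  have h1 := hR (Finset.mem_coe.2 (Finset.mem_image_of_mem _ hz))
  have h2 := Finset.single_le_sum (f := fun i => (z i).natAbs) (fun _ _ => Nat.zero_le _)
    (Finset.mem_univ i)
  rw [Int.abs_eq_natAbs]
  omega

/-- The level at which a set of lattice points splits into several residue classes. -/
theorem exists_split_level {p : ℕ} (hp : 2 ≤ p) {B : Finset (Fin d → ℤ)} (hB : 1 < B.card) :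
    ∃ j, (∀ x ∈ B, ∀ y ∈ B, reduce (p ^ j) x = reduce (p ^ j) y) ∧
      ∃ x ∈ B, ∃ y ∈ B, reduce (p ^ (j + 1)) x ≠ reduce (p ^ (j + 1)) y := by
  obtain ⟨x, hx, y, hy, hxy⟩ := Finset.one_lt_card.1 hB
  obtain ⟨R, hR⟩ := exists_subset_box B
  have hex : ∃ j, ∃ x ∈ B, ∃ y ∈ B, reduce (p ^ (j + 1)) x ≠ reduce (p ^ (j + 1)) y :=
    ⟨2 * R, x, hx, y, hy, fun h => absurd (lt_of_reduce_eq hp (hR hx) (hR hy) hxy h) (lt_irrefl _)⟩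
  classical
  refine ⟨Nat.find hex, fun x hx y hy => ?_, Nat.find_spec hex⟩
  rcases hj : Nat.find hex with _ | j
  · rw [pow_zero]; exact reduce_one_eq x y
  · have := Nat.find_min hex (m := j) (by omega)
    push Not at this
    exact this x hx y hy

/-- Pigeonhole on `(x - x₀) / M` modulo `N`, which takes at most `N ^ d` values. -/
theorem exists_subset_reduce_eq {M N : ℕ} (hM : M ≠ 0) (hN : N ≠ 0) {B : Finset (Fin d → ℤ)}
    (hB : ∀ x ∈ B, ∀ y ∈ B, reduce M x = reduce M y) :
    ∃ B' ⊆ B, B.card ≤ N ^ d * B'.card ∧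
      ∀ x ∈ B', ∀ y ∈ B', reduce (M * N) x = reduce (M * N) y := by
  classical
  rcases B.eq_empty_or_nonempty with rfl | ⟨x₀, hx₀⟩
  · exact ⟨∅, by simp⟩
  have : NeZero N := ⟨hN⟩
  let f : (Fin d → ℤ) → Fin d → ZMod N := fun x => reduce N fun i => (x i - x₀ i) / M
  obtain ⟨c, -, hc⟩ := Finset.exists_max_image (Finset.univ : Finset (Fin d → ZMod N))
    (fun c => (B.filter fun x => f x = c).card) ⟨f x₀, Finset.mem_univ _⟩
  refine ⟨B.filter fun x => f x = c, Finset.filter_subset _ _, ?_, fun x hx y hy => ?_⟩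
  · have := Finset.card_le_mul_card_image_of_maps_to (fun a _ => Finset.mem_univ (f a))
      (s := B) _ fun b hb => hc b hb
    rwa [Finset.card_univ, Fintype.card_fun, ZMod.card, Fintype.card_fin, mul_comm] at this
  · obtain ⟨hxB, hx⟩ := Finset.mem_filter.1 hx
    obtain ⟨hyB, hy⟩ := Finset.mem_filter.1 hy
    refine reduce_eq_iff.2 fun i => ?_
    obtain ⟨k, hk⟩ := reduce_eq_iff.1 (hB x hxB x₀ hx₀) i
    obtain ⟨l, hl⟩ := reduce_eq_iff.1 (hB y hyB x₀ hx₀) i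
    have hM' : (M : ℤ) ≠ 0 := by exact_mod_cast hM
    have h := reduce_eq_iff.1 (hx.trans hy.symm) i
    simp only [hk, hl, Int.mul_ediv_cancel_left _ hM'] at h
    have e : x i - y i = M * (k - l) := by linear_combination hk - hl
    rw [e, Nat.cast_mul]
    exact mul_dvd_mul_left _ h

/-- A large part of a set of lattice points is separated by the whole set, at every lattice point
in a suitable residue class. -/
theorem exists_separating_class {p : ℕ} (hp : 2 ≤ p) (B : Finset (Fin d → ℤ)) :
    ∃ B' ⊆ B, B.card ≤ p ^ d * B'.card ∧ (1 < B'.card → ∃ b ∈ B', ∃ j,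
      (∀ x ∈ B', reduce (p ^ j) x = reduce (p ^ j) b) ∧
      ∀ q, reduce (p ^ (j + 1)) q = reduce (p ^ (j + 1)) b → Separates (rank p) B' B q) := by
  have hp0 : p ≠ 0 := by omega
  rcases Nat.lt_or_ge 1 B.card with hB | hB
  swap
  · exact ⟨B, subset_rfl, Nat.le_mul_of_pos_left _ (by positivity), fun h => by omega⟩
  obtain ⟨j₀, h₀, x, hx, y, hy, hxy⟩ := exists_split_level hp hB
  -- `B'` lies in a single class at the level where `B` splits, so a point `u` of `B` outside this
  -- class is on the same side of all of `B'`.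
  obtain ⟨B', hB', hcard, hred⟩ := exists_subset_reduce_eq (pow_ne_zero j₀ hp0) hp0 h₀
  rw [← pow_succ] at hred
  refine ⟨B', hB', hcard, fun h1 => ?_⟩
  obtain ⟨j₁, h₁, x₁, hx₁, y₁, hy₁, hxy₁⟩ := exists_split_level hp h1
  have hlt : j₀ + 1 ≤ j₁ := by
    by_contra! hlt
    exact hxy₁ (reduce_pow_eq_of_le (by omega) (hred x₁ hx₁ y₁ hy₁))
  obtain ⟨u, hu, hne⟩ : ∃ u ∈ B, reduce (p ^ (j₀ + 1)) u ≠ reduce (p ^ (j₀ + 1)) x₁ := by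
    by_contra! hcon
    exact hxy ((hcon x hx).trans (hcon y hy).symm)
  have split : ∀ b ∈ B', ∃ z ∈ B', rank p j₁ z ≠ rank p j₁ b := by
    intro b hb
    by_contra! hcon
    exact hxy₁ (rank_eq_iff.1 ((hcon x₁ hx₁).trans (hcon y₁ hy₁).symm))
  have prep : ∀ b ∈ B', ∀ q, reduce (p ^ (j₁ + 1)) q = reduce (p ^ (j₁ + 1)) b →
      (∀ l < j₀, rank p l u = rank p l q) ∧ rank p j₀ q = rank p j₀ x₁ ∧
      (∀ a ∈ B', (∀ l < j₁, rank p l a = rank p l q)) ∧ rank p j₁ q = rank p j₁ b ∧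
      (∀ a ∈ B', (∀ l < j₀, rank p l a = rank p l q) ∧ rank p j₀ a = rank p j₀ q) := by
    intro b hb q hq
    have hq₁ := reduce_pow_eq_of_le (Nat.le_succ j₁) hq
    have ha : ∀ a ∈ B', (∀ l < j₁, rank p l a = rank p l q) := fun a ha l hl =>
      rank_eq_of_reduce_eq hl ((h₁ a ha b hb).trans hq₁.symm)
    refine ⟨fun l hl => ?_, (ha x₁ hx₁ j₀ (by omega)).symm, ha, rank_eq_iff.2 hq, fun a haB =>
      ⟨fun l hl => ha a haB l (by omega), ha a haB j₀ (by omega)⟩⟩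
    exact rank_eq_of_reduce_eq hl ((h₀ u hu b (hB' hb)).trans
      (reduce_pow_eq_of_le (by omega) hq₁).symm)
  -- If `u` is below, take `b` lowest in `B'` at the level where `B'` splits: `u` separates below,
  -- another class of `B'` above. If `u` is above, take `b` highest.
  rcases Nat.lt_or_gt_of_ne (mt rank_eq_iff.1 hne) with hlow | hhigh
  · obtain ⟨b, hb, hmin⟩ := Finset.exists_min_image B' (rank p j₁) ⟨x₁, hx₁⟩
    refine ⟨b, hb, j₁, fun x hx => h₁ x hx b hb, fun q hq => ?_⟩
    obtain ⟨e1, e2, e3, e4, e5⟩ := prep b hb q hq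
    obtain ⟨z, hz, hzb⟩ := split b hb
    refine ⟨⟨j₀, u, hu, e1, by rwa [e2], fun a ha => ⟨(e5 a ha).1, (e5 a ha).2.le⟩⟩,
      ⟨j₁, z, hB' hz, e3 z hz, ?_, fun a ha => ⟨e3 a ha, e4 ▸ hmin a ha⟩⟩⟩
    rw [e4]
    exact lt_of_le_of_ne (hmin z hz) hzb.symm
  · obtain ⟨b, hb, hmax⟩ := Finset.exists_max_image B' (rank p j₁) ⟨x₁, hx₁⟩
    refine ⟨b, hb, j₁, fun x hx => h₁ x hx b hb, fun q hq => ?_⟩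
    obtain ⟨e1, e2, e3, e4, e5⟩ := prep b hb q hq
    obtain ⟨z, hz, hzb⟩ := split b hb
    refine ⟨⟨j₁, z, hB' hz, e3 z hz, ?_, fun a ha => ⟨e3 a ha, e4 ▸ hmax a ha⟩⟩,
      ⟨j₀, u, hu, e1, by rwa [e2], fun a ha => ⟨(e5 a ha).1, (e5 a ha).2.ge⟩⟩⟩
    rw [e4]
    exact lt_of_le_of_ne (hmax z hz) hzb

end Residues

/-! ### Finding a point balanced and separated for all primes. -/

section Selection

variable {d : ℕ}

theorem exists_separating_chain {p : ℕ → ℕ} (hp : ∀ i, 2 ≤ p i) (r : ℕ) (A : Finset (Fin d → ℤ)) :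
    ∃ X : ℕ → Finset (Fin d → ℤ), X r = A ∧ (∀ i < r, X i ⊆ X (i + 1)) ∧
      A.card ≤ (∏ i ∈ Finset.range r, p i) ^ d * (X 0).card ∧
      ∀ i < r, 1 < (X i).card → ∃ b ∈ X i, ∃ j,
        (∀ x ∈ X i, reduce (p i ^ j) x = reduce (p i ^ j) b) ∧
        ∀ q, reduce (p i ^ (j + 1)) q = reduce (p i ^ (j + 1)) b →
          Separates (rank (p i)) (X i) (X (i + 1)) q := by
  induction r generalizing A with
  | zero => exact ⟨fun _ => A, rfl, by simp, by simp, by simp⟩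
  | succ r ih =>
    obtain ⟨B, hBA, hcard, hB⟩ := exists_separating_class (hp r) A
    obtain ⟨X, hX, hmono, hc, hsep⟩ := ih B
    refine ⟨fun i => if i ≤ r then X i else A, by simp, fun i hi => ?_, ?_, fun i hi => ?_⟩
    · rcases (Nat.lt_succ_iff.1 hi).lt_or_eq with h | rfl
      · simpa [h.le, Nat.succ_le_of_lt h] using hmono i h
      · simpa [hX] using hBA
    · simp only [Nat.zero_le, if_true]
      rw [Finset.prod_range_succ, mul_pow, mul_right_comm, mul_comm]
      exact hcard.trans (Nat.mul_le_mul_left _ hc)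
    · rcases (Nat.lt_succ_iff.1 hi).lt_or_eq with h | rfl
      · simpa [h.le, Nat.succ_le_of_lt h] using hsep i h
      · simpa [hX] using hB

@[simp] theorem latticePoint_inj {x y : Fin d → ℤ} : latticePoint x = latticePoint y ↔ x = y := by
  refine ⟨fun h => funext fun i => ?_, fun h => h ▸ rfl⟩
  have := congrArg (fun v : EuclideanSpace ℝ (Fin d) => v i) h
  simpa using this

/-- A set of lattice points that are congruent modulo a large number balances some point of any
given residue class represented in its affine hull. -/
theorem exists_balancedAt_latticePoint {m : ℕ} {Y : Finset (Fin d → ℤ)} {y₀ q₀ : Fin d → ℤ}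
    (hy₀ : y₀ ∈ Y) (hY : ∀ y ∈ Y, reduce (m * (d + 1)) y = reduce (m * (d + 1)) y₀)
    (hq₀ : latticePoint q₀ - latticePoint y₀ ∈ vectorSpan ℝ (latticePoint '' (Y : Set (Fin d → ℤ)))) :
    ∃ q, ∃ C ⊆ Y, C.Nonempty ∧ reduce m q = reduce m q₀ ∧ BalancedAt latticePoint C q ∧
      vectorSpan ℝ (latticePoint '' (Y : Set (Fin d → ℤ))) ≤ spread latticePoint C q := by
  classical
  let f : (Fin d → ℤ) → EuclideanSpace ℝ (Fin d) := fun z => latticePoint z - latticePoint y₀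
  have hV : vectorSpan ℝ (latticePoint '' (Y : Set (Fin d → ℤ))) = Submodule.span ℝ (f '' Y) := by
    rw [vectorSpan_eq_span_vsub_set_right ℝ (Set.mem_image_of_mem latticePoint hy₀),
      Set.image_image]
    rfl
  -- A basis of the direction space among the differences from `y₀`; all its vectors are divisible
  -- by `m * (d + 1)`.
  obtain ⟨s, hsY, hscard, hs⟩ : ∃ s ⊆ Y, s.card ≤ d ∧
      Submodule.span ℝ (f '' s) = Submodule.span ℝ (f '' Y) := by
    obtain ⟨t, ht, htc, hts, -⟩ := Submodule.exists_finset_span_eq_linearIndepOn ℝ (f '' Y)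
    choose! y hyY hy using fun v (hv : v ∈ t) => ht hv
    refine ⟨t.image y, Finset.image_subset_iff.2 hyY, ?_, ?_⟩
    · refine Finset.card_image_le.trans (htc.le.trans ((Submodule.finrank_le _).trans_eq ?_))
      exact finrank_euclideanSpace_fin
    · rw [← hts, Finset.coe_image, Set.image_image, Set.image_congr fun v hv => hy v hv,
        Set.image_id']
  rw [hV, ← hs] at hq₀ ⊢
  obtain ⟨x, hx⟩ := (Submodule.mem_span_image_finset_iff_exists_fun' ℝ).1 hq₀
  have hd : (0 : ℝ) < d + 1 := by positivity
  -- Subtracting `n a / (d + 1)` puts each coefficient in `(0, 1 / (d + 1)]`; the ceiling minus one,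
  -- unlike the floor, excludes zero. At most `d` of them sum to less than 1, leaving a positive
  -- weight for `y₀`.
  let n : (Fin d → ℤ) → ℤ := fun a => ⌈(d + 1) * x a⌉ - 1
  let x' : (Fin d → ℤ) → ℝ := fun a => x a - n a / (d + 1)
  have hx'pos : ∀ a, 0 < x' a := fun a => by
    have := Int.ceil_lt_add_one ((d + 1) * x a)
    simp only [x', n, sub_pos, div_lt_iff₀ hd]
    push_cast
    linarith
  have hx'le : ∀ a, x' a ≤ 1 / (d + 1) := fun a => by
    have := Int.le_ceil ((d + 1) * x a)
    simp only [x', n]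
    rw [sub_le_iff_le_add, ← add_div, le_div_iff₀ hd]
    push_cast
    linarith
  have hsum : ∑ a ∈ s, x' a < 1 := by
    calc ∑ a ∈ s, x' a ≤ s.card • (1 / ((d : ℝ) + 1)) := Finset.sum_le_card_nsmul _ _ _ fun a _ =>
          hx'le a
      _ ≤ d * (1 / ((d : ℝ) + 1)) := by
          rw [nsmul_eq_mul]
          gcongr
      _ < 1 := by rw [mul_one_div, div_lt_one hd]; linarith
  choose! g hg using fun y hy => fun i => reduce_eq_iff.1 (hY y hy) i
  -- The correction is an integral vector divisible by `m`, so the residue of `q₀` survives.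
  let q : Fin d → ℤ := fun i => q₀ i - ∑ a ∈ s, n a * (m * g a i)
  have hfq : f q = ∑ a ∈ s, x' a • f a := by
    have h1 : f q = f q₀ - ∑ a ∈ s, (n a / (d + 1) : ℝ) • f a := by
      ext i
      simp only [f, q, PiLp.sub_apply, latticePoint_apply, WithLp.ofLp_sum, Finset.sum_apply,
        WithLp.ofLp_smul, Pi.smul_apply, smul_eq_mul]
      push_cast
      have : ∀ a ∈ s, (n a / (d + 1) : ℝ) * (a i - y₀ i) = n a * (m * g a i) := fun a ha => by
        have := hg a (hsY ha) i
        have h2 : ((a i - y₀ i : ℤ) : ℝ) = ((m * (d + 1) : ℕ) : ℤ) * g a i := by exact_mod_cast this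
        push_cast at h2
        rw [h2]
        field_simp
      rw [Finset.sum_congr rfl this]
      ring
    rw [h1]
    show latticePoint q₀ - latticePoint y₀ - _ = _
    rw [← hx, ← Finset.sum_sub_distrib]
    simp only [x', sub_smul]
  have hdiff : ∀ a, latticePoint a - latticePoint q = f a - f q := fun a => by
    simp only [f]; abel
  refine ⟨q, insert y₀ s, Finset.insert_subset hy₀ hsY, Finset.insert_nonempty _ _, ?_, ?_, ?_⟩
  · refine reduce_eq_iff.2 fun i => ?_
    simp only [q, sub_sub_cancel_left, dvd_neg]
    exact Finset.dvd_sum fun a _ => (dvd_mul_right _ _).mul_left _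
  · set σ := ∑ a ∈ s, x' a with hσ
    have h1 : 0 < 1 - σ := by linarith
    refine ⟨fun a => (if a ∈ s then x' a / (1 - σ) else 0) + if a = y₀ then 1 else 0, ?_, ?_⟩
    · intro a ha
      have h2 := div_pos (hx'pos a) h1
      beta_reduce
      by_cases has : a ∈ s <;> by_cases hay : a = y₀
      · rw [if_pos has, if_pos hay]; linarith
      · rw [if_pos has, if_neg hay]; linarith
      · rw [if_neg has, if_pos hay]; linarith
      · simp [has, hay] at ha
    · rw [sum_insert_ite_smul]
      simp only [hdiff, smul_sub, Finset.sum_sub_distrib, ← Finset.sum_smul, div_eq_inv_mul,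
        mul_smul, ← Finset.smul_sum, ← hfq, ← hσ]
      have h0 : f y₀ = 0 := sub_self _
      rw [h0, zero_sub, ← smul_sub]
      have h3 : f q - σ • f q = (1 - σ) • f q := by rw [sub_smul, one_smul]
      rw [h3, smul_smul, inv_mul_cancel₀ h1.ne', one_smul, add_neg_cancel]
  · refine Submodule.span_le.2 ?_
    rintro _ ⟨a, ha, rfl⟩
    have e : f a = (latticePoint a - latticePoint q) - (latticePoint y₀ - latticePoint q) := by
      simp only [f]; abel
    rw [SetLike.mem_coe, e]
    exact Submodule.sub_mem _ (sub_mem_spread (Finset.mem_insert_of_mem ha))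
      (sub_mem_spread (Finset.mem_insert_self _ _))

theorem exists_int_modEq_one {r : ℕ} {P : ℕ → ℕ}
    (hP : ∀ i < r, ∀ l < r, i ≠ l → (P i).Coprime (P l)) :
    ∃ e : ℕ → ℤ, ∀ i < r, (P i : ℤ) ∣ e i - 1 ∧ ∀ l < r, l ≠ i → (P l : ℤ) ∣ e i := by
  have key : ∀ i, ∃ e : ℤ, i < r → (P i : ℤ) ∣ e - 1 ∧ ∀ l < r, l ≠ i → (P l : ℤ) ∣ e := by
    intro i
    by_cases hi : i < r
    swap
    · exact ⟨0, fun h => absurd h hi⟩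
    have hcop : IsCoprime (P i : ℤ) (∏ l ∈ (Finset.range r).erase i, P l : ℕ) :=
      Nat.isCoprime_iff_coprime.2 (Nat.Coprime.prod_right fun l hl => by
        obtain ⟨h1, h2⟩ := Finset.mem_erase.1 hl
        exact hP i hi l (Finset.mem_range.1 h2) h1.symm)
    obtain ⟨a, b, hab⟩ := hcop
    refine ⟨b * (∏ l ∈ (Finset.range r).erase i, P l : ℕ), fun _ => ⟨⟨-a, ?_⟩, fun l hl hli => ?_⟩⟩
    · linear_combination hab
    · exact (Int.natCast_dvd_natCast.2 (Finset.dvd_prod_of_mem P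
        (Finset.mem_erase.2 ⟨hli, Finset.mem_range.2 hl⟩))).mul_left _
  choose e he using key
  exact ⟨e, he⟩

/-- The lattice points of an affine subspace can be prescribed modulo coprime numbers. -/
theorem exists_reduce_eq_of_coprime {r : ℕ} {P : ℕ → ℕ}
    (hP : ∀ i < r, ∀ l < r, i ≠ l → (P i).Coprime (P l)) (W : Submodule ℝ (EuclideanSpace ℝ (Fin d)))
    (y₀ : Fin d → ℤ) (b : ℕ → Fin d → ℤ) (hb : ∀ i < r, latticePoint (b i) - latticePoint y₀ ∈ W) :
    ∃ q, latticePoint q - latticePoint y₀ ∈ W ∧ ∀ i < r, reduce (P i) q = reduce (P i) (b i) := by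
  obtain ⟨e, he⟩ := exists_int_modEq_one hP
  -- An integral affine combination of `y₀` and the `b i` stays in the affine subspace, and its
  -- weights are Chinese remainder idempotents.
  refine ⟨fun k => y₀ k + ∑ i ∈ Finset.range r, e i * (b i k - y₀ k), ?_, fun i hi => ?_⟩
  · have : latticePoint (fun k => y₀ k + ∑ i ∈ Finset.range r, e i * (b i k - y₀ k)) -
        latticePoint y₀ = ∑ i ∈ Finset.range r, (e i : ℝ) • (latticePoint (b i) - latticePoint y₀) := by
      ext k
      simp
    rw [this]
    exact Submodule.sum_mem _ fun i hi => Submodule.smul_mem _ _ (hb i (Finset.mem_range.1 hi))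
  · refine reduce_eq_iff.2 fun k => ?_
    rw [← Finset.add_sum_erase _ _ (Finset.mem_range.2 hi)]
    have h1 : (P i : ℤ) ∣ ∑ l ∈ (Finset.range r).erase i, e l * (b l k - y₀ k) :=
      Finset.dvd_sum fun l hl => by
        obtain ⟨h1, h2⟩ := Finset.mem_erase.1 hl
        exact ((he l (Finset.mem_range.1 h2)).2 i hi h1.symm).mul_right _
    have h2 := (he i hi).1.mul_right (b i k - y₀ k)
    have := dvd_add h2 h1
    rw [show y₀ k + (e i * (b i k - y₀ k) + ∑ l ∈ (Finset.range r).erase i, e l * (b l k - y₀ k)) -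
      b i k = (e i - 1) * (b i k - y₀ k) +
        ∑ l ∈ (Finset.range r).erase i, e l * (b l k - y₀ k) by ring]
    exact this

/-- A nested sequence of parts of `A`, each separated at `q` by the next one, the smallest of which
is balanced at `q`. -/
theorem exists_separating_balanced {p : ℕ → ℕ} (hp : ∀ i, 2 ≤ p i) {r : ℕ}
    (hcop : ∀ i < r, ∀ l < r, i ≠ l → (p i).Coprime (p l)) {N : ℕ}
    (hN : ∏ i ∈ Finset.range r, p i = N) (D : ℕ) (A : Finset (Fin d → ℤ))
    (hD : Module.finrank ℝ (vectorSpan ℝ (latticePoint '' (A : Set (Fin d → ℤ)))) ≤ D)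
    (hA : ((N * (N * (d + 1))) ^ d) ^ D < A.card) :
    ∃ q, ∃ X : ℕ → Finset (Fin d → ℤ), X r ⊆ A ∧ (∀ i < r, X i ⊆ X (i + 1)) ∧ (X 0).Nonempty ∧
      BalancedAt latticePoint (X 0) q ∧
      (∀ u ∈ X r, latticePoint u - latticePoint q ∈ spread latticePoint (X 0) q) ∧
      ∀ i < r, Separates (rank (p i)) (X i) (X (i + 1)) q := by
  have hNpos : 0 < N := hN ▸ Finset.prod_pos fun i _ => by have := hp i; omega
  induction D generalizing A with
  | zero =>
    exfalso
    rw [pow_zero] at hA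
    obtain ⟨x, hx, y, hy, hxy⟩ := Finset.one_lt_card.1 hA
    rw [Nat.le_zero, Submodule.finrank_eq_zero] at hD
    have h := vsub_mem_vectorSpan ℝ (Set.mem_image_of_mem latticePoint (Finset.mem_coe.2 hx))
      (Set.mem_image_of_mem latticePoint (Finset.mem_coe.2 hy))
    rw [hD, Submodule.mem_bot, vsub_eq_sub, sub_eq_zero, latticePoint_inj] at h
    exact hxy h
  | succ D ih =>
    obtain ⟨X, hXr, hmono, hcard, hX⟩ := exists_separating_chain hp r A
    rw [hN] at hcard
    have hsub : ∀ k, ∀ i, i + k ≤ r → X i ⊆ X (i + k) := by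
      intro k
      induction k with
      | zero => exact fun i _ => subset_rfl
      | succ k ihk => exact fun i hi => (ihk i (by omega)).trans (hmono _ (by omega))
    have hsub' : ∀ i ≤ r, ∀ l ≤ r, i ≤ l → X i ⊆ X l := fun i _ l hl hil => by
      simpa [Nat.add_sub_cancel' hil] using hsub (l - i) i (by omega)
    have hR : 1 ≤ ((N * (N * (d + 1))) ^ d) ^ D := Nat.one_le_iff_ne_zero.2 (by positivity)
    have hX0 : (N * (d + 1)) ^ d * ((N * (N * (d + 1))) ^ d) ^ D < (X 0).card := by
      have h1 := hA.trans_le hcard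
      rw [pow_succ', mul_pow N (N * (d + 1)) d, mul_assoc] at h1
      rw [mul_pow N (N * (d + 1)) d]
      exact lt_of_mul_lt_mul_left h1 (Nat.zero_le _)
    have h1X0 : 1 < (X 0).card := by
      refine lt_of_le_of_lt ?_ hX0
      exact Nat.one_le_iff_ne_zero.2 (by positivity)
    have h1X : ∀ i < r, 1 < (X i).card := fun i hi =>
      h1X0.trans_le (Finset.card_le_card (hsub' 0 (Nat.zero_le _) i hi.le (Nat.zero_le _)))
    choose! b hb j hj hsep using fun i hi => hX i hi (h1X i hi)
    obtain ⟨x₀, hx₀⟩ := Finset.card_pos.1 (zero_lt_one.trans h1X0)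
    set M := ∏ i ∈ Finset.range r, p i ^ j i with hM
    have hMpos : 0 < M := Finset.prod_pos fun i _ => by
      have := hp i
      positivity
    have hcopP : ∀ i < r, ∀ l < r, i ≠ l → (p i ^ (j i + 1)).Coprime (p l ^ (j l + 1)) :=
      fun i hi l hl hil => (hcop i hi l hl hil).pow _ _
    have hredM : ∀ x ∈ X 0, ∀ y ∈ X 0, reduce M x = reduce M y := by
      intro x hx y hy
      refine reduce_eq_iff.2 fun k => ?_
      rw [hM, Nat.cast_prod]
      refine Finset.prod_dvd_of_coprime ?_ fun i hi => ?_
      · intro i hi l hl hil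
        exact Nat.isCoprime_iff_coprime.2
          ((hcop i (by simpa using hi) l (by simpa using hl) hil).pow _ _)
      · have hi' := Finset.mem_range.1 hi
        have h0 := hsub' 0 (Nat.zero_le _) i hi'.le (Nat.zero_le _)
        exact reduce_eq_iff.1 ((hj i hi' x (h0 hx)).trans (hj i hi' y (h0 hy)).symm) k
    -- Passing from `A` to `X 0` costs a factor `N ^ d`, and to `Y` another `(N * (d + 1)) ^ d`.
    -- Their product is the base of the power in `hA`, so one round uses up one factor.
    obtain ⟨Y, hYX, hYcard, hYred⟩ := exists_subset_reduce_eq hMpos.ne'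
      (by positivity : N * (d + 1) ≠ 0) hredM
    have hY : ((N * (N * (d + 1))) ^ d) ^ D < Y.card :=
      lt_of_mul_lt_mul_left (hX0.trans_le hYcard) (Nat.zero_le _)
    have hYA : Y ⊆ A := hXr ▸ hYX.trans (hsub' 0 (Nat.zero_le _) r le_rfl (Nat.zero_le _))
    -- If the dimension has dropped, restart inside `Y`. Otherwise `Y` spans the affine hull of `A`,
    -- and every `b i` is available for the choice of `q₀`.
    by_cases hdim : Module.finrank ℝ (vectorSpan ℝ (latticePoint '' (Y : Set (Fin d → ℤ)))) ≤ D
    · obtain ⟨q, X', h1, h2⟩ := ih Y hdim hY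
      exact ⟨q, X', h1.trans hYA, h2⟩
    have hle : vectorSpan ℝ (latticePoint '' (Y : Set (Fin d → ℤ))) ≤
        vectorSpan ℝ (latticePoint '' (A : Set (Fin d → ℤ))) :=
      vectorSpan_mono ℝ (Set.image_mono (by exact_mod_cast hYA))
    have hspan := Submodule.eq_of_le_of_finrank_le hle (by omega)
    obtain ⟨y₀, hy₀⟩ := Finset.card_pos.1 ((Nat.zero_le _).trans_lt hY)
    have hAsub : ∀ x ∈ A, ∀ y ∈ A, latticePoint x - latticePoint y ∈
        vectorSpan ℝ (latticePoint '' (Y : Set (Fin d → ℤ))) := fun x hx y hy =>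
      hspan ▸ vsub_mem_vectorSpan ℝ (Set.mem_image_of_mem latticePoint (Finset.mem_coe.2 hx))
        (Set.mem_image_of_mem latticePoint (Finset.mem_coe.2 hy))
    have hXA : ∀ i ≤ r, X i ⊆ A := fun i hi => hXr ▸ hsub' i hi r le_rfl hi
    obtain ⟨q₀, hq₀, hq₀b⟩ := exists_reduce_eq_of_coprime hcopP _ y₀ b
      fun i hi => hAsub _ (hXA i hi.le (hb i hi)) _ (hYA hy₀)
    obtain ⟨q, C, hCY, hC, hq, hbal, hspr⟩ := exists_balancedAt_latticePoint (m := M * N) hy₀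
      (fun y hy => by rw [mul_assoc]; exact hYred y hy y₀ hy₀) hq₀
    obtain ⟨c, hc⟩ := hC
    -- `M * N` is divisible by every `p i ^ (j i + 1)`, so replacing `q₀` by `q` keeps the
    -- prescribed classes.
    have hqsep : ∀ i < r, Separates (rank (p i)) (X i) (X (i + 1)) q := fun i hi => by
      refine hsep i hi q ((reduce_eq_of_dvd ?_ hq).trans (hq₀b i hi))
      rw [pow_succ, hM, ← hN]
      exact mul_dvd_mul (Finset.dvd_prod_of_mem (fun i => p i ^ j i) (Finset.mem_range.2 hi))
        (Finset.dvd_prod_of_mem p (Finset.mem_range.2 hi))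
    have hspr' : ∀ u ∈ A, latticePoint u - latticePoint q ∈ spread latticePoint C q := fun u hu => by
      rw [← sub_add_sub_cancel _ (latticePoint c)]
      exact Submodule.add_mem _ (hspr (hAsub u hu c (hYA (hCY hc)))) (sub_mem_spread hc)
    classical
    refine ⟨q, Function.update X 0 C, ?_, fun i hi => ?_, ?_, ?_, ?_, fun i hi => ?_⟩
    · rcases r.eq_zero_or_pos with rfl | hr
      · rw [Function.update_self]; exact hCY.trans hYA
      · rw [Function.update_of_ne hr.ne', hXr]
    · rw [Function.update_of_ne (Nat.succ_ne_zero i)]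
      rcases i.eq_zero_or_pos with rfl | hi0
      · rw [Function.update_self]; exact (hCY.trans hYX).trans (hmono 0 hi)
      · rw [Function.update_of_ne hi0.ne']; exact hmono i hi
    · rw [Function.update_self]; exact ⟨c, hc⟩
    · rw [Function.update_self]; exact hbal
    · rw [Function.update_self]
      intro u hu
      refine hspr' u ?_
      rcases r.eq_zero_or_pos with rfl | hr
      · rw [Function.update_self] at hu; exact hYA (hCY hu)
      · rwa [Function.update_of_ne hr.ne', hXr] at hu
    · rw [Function.update_of_ne (Nat.succ_ne_zero i)]
      rcases i.eq_zero_or_pos with rfl | hi0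
      · rw [Function.update_self]; exact (hqsep 0 hi).anti (hCY.trans hYX)
      · rw [Function.update_of_ne hi0.ne']; exact hqsep i hi

end Selection

/-! ### Perturbing in one direction after another. -/

section Stages

variable {d : ℕ}

theorem BalancedAt.mem_box {C : Finset (Fin d → ℤ)} {q : Fin d → ℤ} {R : ℕ}
    (h : BalancedAt latticePoint C q) (hne : C.Nonempty) (hC : C ⊆ box d R) : q ∈ box d R := by
  obtain ⟨t, ht, hsum⟩ := h
  have hcoord : ∀ i, ∑ a ∈ C, t a * ((a i : ℝ) - q i) = 0 := fun i => by
    have := congrArg (fun v : EuclideanSpace ℝ (Fin d) => v i) hsum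
    simpa using this
  refine _root_.mem_box.2 fun i => ?_
  by_contra! hlt
  rcases lt_abs.1 hlt with h1 | h1
  · refine (Finset.sum_neg (fun a ha => mul_neg_of_pos_of_neg (ht a ha) ?_) hne).ne (hcoord i)
    have := (le_abs_self _).trans (_root_.mem_box.1 (hC ha) i)
    rw [sub_neg]
    exact_mod_cast this.trans_lt h1
  · refine (Finset.sum_pos (fun a ha => mul_pos (ht a ha) ?_) hne).ne' (hcoord i)
    have := (neg_le_abs _).trans (_root_.mem_box.1 (hC ha) i)
    rw [sub_pos]
    have h2 : q i < a i := by linarith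
    exact_mod_cast h2

/-- Stage `i` uses the prime `p i` and the direction `v i`, and draws on `X (i + 1)` to tilt a
relation already found inside `X i`. Directions gained earlier are kept. -/
theorem exists_iterated_perturbation (R : ℕ) {p : ℕ → ℕ} (hp : ∀ i, 2 ≤ p i)
    (v : ℕ → EuclideanSpace ℝ (Fin d)) (hv : ∀ i, ‖v i‖ ≤ 1) {δ : ℝ} (hδ : 0 < δ) (r : ℕ) :
    ∃ π : (Fin d → ℤ) → EuclideanSpace ℝ (Fin d),
      (∀ z ∈ box d R, ‖π z - latticePoint z‖ ≤ r * δ) ∧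
      (∀ z, π z - latticePoint z ∈ Submodule.span ℝ (v '' Set.Iio r)) ∧
      ∀ q ∈ box d R, ∀ X : ℕ → Finset (Fin d → ℤ), X r ⊆ box d R → (∀ i < r, X i ⊆ X (i + 1)) →
        BalancedAt latticePoint (X 0) q →
        (∀ u ∈ X r, latticePoint u - latticePoint q ∈ spread latticePoint (X 0) q) →
        (∀ i < r, Separates (rank (p i)) (X i) (X (i + 1)) q) →
        ∃ C ⊆ X r, BalancedAt π C q ∧ spread latticePoint (X 0) q ≤ spread π C q ∧
          ∀ i < r, v i ∈ spread π C q := by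
  induction r with
  | zero =>
    exact ⟨latticePoint, by simp, by simp, fun q _ X _ _ hb _ _ =>
      ⟨X 0, subset_rfl, hb, le_rfl, by simp⟩⟩
  | succ r ih =>
    obtain ⟨π, hπ, hspan, H⟩ := ih
    obtain ⟨h, hh, hlift⟩ := exists_height (box d R) π (rank (p r)) (v r) hδ
      (lt_of_rank_ne (hp r))
    have hmono : Submodule.span ℝ (v '' Set.Iio r) ≤ Submodule.span ℝ (v '' Set.Iio (r + 1)) :=
      Submodule.span_mono (Set.image_mono (Set.Iio_subset_Iio (Nat.le_succ r)))
    refine ⟨fun z => π z + h z • v r, fun z hz => ?_, fun z => ?_, ?_⟩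
    · rw [add_sub_right_comm]
      refine (norm_add_le _ _).trans ?_
      have h1 : ‖h z • v r‖ ≤ δ := by
        rw [norm_smul]
        exact (mul_le_of_le_one_right (norm_nonneg _) (hv r)).trans (hh z hz)
      push_cast
      linarith [hπ z hz]
    · rw [add_sub_right_comm]
      exact Submodule.add_mem _ (hmono (hspan z)) (Submodule.smul_mem _ _
        (Submodule.subset_span ⟨r, Set.mem_Iio.2 (Nat.lt_succ_self r), rfl⟩))
    · intro q hq X hX hXm hb hu hsep
      have hXr := hXm r (Nat.lt_succ_self r)
      obtain ⟨C, hC, hbal, hs, hvs⟩ := H q hq X (hXr.trans hX) (fun i hi => hXm i (by omega)) hb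
        (fun u hu' => hu u (hXr hu')) fun i hi => hsep i (by omega)
      have hspan' : Submodule.span ℝ (v '' Set.Iio r) ≤ spread π C q := by
        refine Submodule.span_le.2 ?_
        rintro _ ⟨i, hi, rfl⟩
        exact hvs i hi
      obtain ⟨C', hC', hb', hv', hs'⟩ := hlift C ((hC.trans hXr).trans hX) (X (r + 1)) hX q hq hbal
        (fun u hu' => by
          -- Displacements so far are combinations of directions already in the spread, so the moved
          -- points still lie in it.
          rw [show π u - π q = (latticePoint u - latticePoint q) + (π u - latticePoint u) -
            (π q - latticePoint q) by abel]
          exact Submodule.sub_mem _ (Submodule.add_mem _ (hs (hu u hu')) (hspan' (hspan u)))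
            (hspan' (hspan q))) ((hsep r (Nat.lt_succ_self r)).anti hC)
      refine ⟨C', hC'.trans (Finset.union_subset (hC.trans hXr) subset_rfl), hb', hs.trans hs',
        fun i hi => ?_⟩
      rcases (Nat.lt_succ_iff.1 hi).lt_or_eq with hlt | rfl
      · exact hs' (hvs i hlt)
      · exact hv'

/-- A perturbation of a large cube of `ℤ^d` without large holes. -/
theorem exists_crowded_perturbation (hd : d ≠ 0) {p : ℕ → ℕ} (hp : ∀ i, 2 ≤ p i)
    (hcop : ∀ i < d, ∀ l < d, i ≠ l → (p i).Coprime (p l)) {N : ℕ}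
    (hN : ∏ i ∈ Finset.range d, p i = N) (R : ℕ) :
    ∃ π : (Fin d → ℤ) → EuclideanSpace ℝ (Fin d),
      (∀ z ∈ box d R, ‖π z - latticePoint z‖ ≤ 1) ∧
      Crowded π (box d R) (((N * (N * (d + 1))) ^ d) ^ d + 1) := by
  let v : ℕ → EuclideanSpace ℝ (Fin d) := fun i =>
    if h : i < d then EuclideanSpace.single ⟨i, h⟩ 1 else 0
  have hv : ∀ i, ‖v i‖ ≤ 1 := fun i => by
    by_cases h : i < d <;> simp [v, h]
  have hd' : (0 : ℝ) < d := by exact_mod_cast Nat.pos_of_ne_zero hd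
  obtain ⟨π, h1, -, h2⟩ := exists_iterated_perturbation R hp v hv (inv_pos.2 hd') d
  refine ⟨π, fun z hz => ?_, fun A hA hcard => ?_⟩
  · simpa [hd'.ne'] using h1 z hz
  · obtain ⟨q, X, hXA, hmono, hne, hbal, hu, hsep⟩ := exists_separating_balanced hp hcop hN d A
      ((Submodule.finrank_le _).trans_eq finrank_euclideanSpace_fin) (by omega)
    have hsub : ∀ i ≤ d, X 0 ⊆ X i := fun i => by
      induction i with
      | zero => exact fun _ => subset_rfl
      | succ i ih => exact fun hi => (ih (by omega)).trans (hmono i (by omega))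
    have hq := hbal.mem_box hne ((hsub d le_rfl).trans (hXA.trans hA))
    obtain ⟨C, hC, hb, -, hvC⟩ := h2 q hq X (hXA.trans hA) hmono hbal hu hsep
    refine ⟨q, hq, (hb.surrounds ?_).mono (hC.trans hXA)⟩
    rw [eq_top_iff, ← (EuclideanSpace.basisFun (Fin d) ℝ).toBasis.span_eq, Submodule.span_le]
    rintro _ ⟨i, rfl⟩
    have := hvC i i.2
    simpa [v] using this

end Stages

/-! ### The size of the constant. -/

section Bound

/-- A Chebyshev lower bound, with much to spare, gives at least `d` primes up to `d ^ 4`. -/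
theorem nth_prime_le {d : ℕ} (hd : 3 ≤ d) {i : ℕ} (hi : i < d) : Nat.nth Nat.Prime i ≤ d ^ 4 := by
  have hd' : (3 : ℝ) ≤ d := by exact_mod_cast hd
  have h1 := Chebyshev.pi_ge (d ^ 4)
  push_cast at h1
  have hlog : Real.log d ≤ d := (Real.log_le_sub_one_of_pos (by linarith)).trans (by linarith)
  have hlogpos : 0 < Real.log d := Real.log_pos (by linarith)
  have hlog2 := Real.log_two_gt_d9
  have hlog2' := Real.log_two_lt_d9
  have h2 : Real.log ((d : ℝ) ^ 4 + 1) ≤ Real.log 2 + 4 * Real.log d := by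
    rw [← Real.log_rpow (by linarith), ← Real.log_mul (by norm_num) (by positivity)]
    refine Real.log_le_log (by positivity) ?_
    have : (1 : ℝ) ≤ (d : ℝ) ^ 4 := one_le_pow₀ (by linarith)
    have e : (d : ℝ) ^ (4 : ℝ) = (d : ℝ) ^ 4 := by exact_mod_cast Real.rpow_natCast (d : ℝ) 4
    rw [e]
    linarith
  have h3 : (d : ℝ) ≤ Nat.primeCounting (d ^ 4) := by
    refine le_trans ?_ h1
    rw [Real.log_pow, le_div_iff₀ (by positivity)]
    push_cast
    have h4 : (d : ℝ) * (4 * Real.log d) ≤ d * (4 * d) := by gcongr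
    have h5 : 9 * (d : ℝ) ^ 2 ≤ (d : ℝ) ^ 4 := by
      have h6 : (9 : ℝ) ≤ (d : ℝ) ^ 2 := by nlinarith
      nlinarith [sq_nonneg (d : ℝ)]
    nlinarith
  have h6 : d ≤ Nat.primeCounting (d ^ 4) := by exact_mod_cast h3
  exact Nat.lt_succ_iff.1 (Nat.nth_lt_of_lt_count (hi.trans_le h6))

theorem two_le_nth_prime (i : ℕ) : 2 ≤ Nat.nth Nat.Prime i := (Nat.prime_nth_prime i).two_le

theorem coprime_nth_prime {i l : ℕ} (h : i ≠ l) :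
    (Nat.nth Nat.Prime i).Coprime (Nat.nth Nat.Prime l) :=
  (Nat.coprime_primes (Nat.prime_nth_prime i) (Nat.prime_nth_prime l)).2
    fun e => h (Nat.nth_injective Nat.infinite_setOfPred_prime e)

/-- From `N ≤ d ^ (4 * d)` and `d + 1 ≤ d ^ 2` the main term is at most `d ^ (8 * d ^ 3 + 2 * d ^
2)`; adding `1 + d` at most doubles this, and 12 absorbs the rest. -/
theorem crowding_constant_le {d : ℕ} (hd : 3 ≤ d) {N : ℕ}
    (hN : ∏ i ∈ Finset.range d, Nat.nth Nat.Prime i = N) :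
    ((N * (N * (d + 1))) ^ d) ^ d + 1 + d ≤ d ^ (12 * d ^ 3) := by
  have h1 : N ≤ d ^ (4 * d) := by
    rw [← hN, pow_mul]
    calc ∏ i ∈ Finset.range d, Nat.nth Nat.Prime i ≤ ∏ _i ∈ Finset.range d, d ^ 4 :=
          Finset.prod_le_prod' fun i hi => nth_prime_le hd (Finset.mem_range.1 hi)
      _ = (d ^ 4) ^ d := by simp
  have h2 : d + 1 ≤ d ^ 2 := by nlinarith
  have h3 : ((N * (N * (d + 1))) ^ d) ^ d ≤ d ^ (8 * d ^ 3 + 2 * d ^ 2) :=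
    calc ((N * (N * (d + 1))) ^ d) ^ d
        ≤ ((d ^ (4 * d) * (d ^ (4 * d) * d ^ 2)) ^ d) ^ d := by gcongr
      _ = d ^ (8 * d ^ 3 + 2 * d ^ 2) := by
        rw [← pow_add, ← pow_add, ← pow_mul, ← pow_mul]
        congr 1
        ring
  have h4 : 1 + d ≤ d ^ (8 * d ^ 3 + 2 * d ^ 2) := by
    rw [add_comm]
    exact h2.trans (Nat.pow_le_pow_right (by omega) (by nlinarith))
  calc ((N * (N * (d + 1))) ^ d) ^ d + 1 + d
      ≤ d ^ (8 * d ^ 3 + 2 * d ^ 2) * 2 := by omega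
    _ ≤ d ^ (8 * d ^ 3 + 2 * d ^ 2) * d := by gcongr; omega
    _ = d ^ (8 * d ^ 3 + 2 * d ^ 2 + 1) := (pow_succ _ _).symm
    _ ≤ d ^ (12 * d ^ 3) := Nat.pow_le_pow_right (by omega) (by nlinarith [sq_nonneg d])

end Bound

/-! ### Seven points of the planar lattice. -/

section PlanarLattice

/-- The triangle with vertices `(0, 0)`, `(g, 0)`, `(x, y)` meets height 1 in a segment with
interior `x < k * y < x + g * (y - 1)`; so `(k, 1)` is an interior point. -/
theorem exists_interior_of_le_height {g x y : ℤ} (hy : 2 ≤ y) {k : ℤ}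
    (h1 : x < k * y) (h2 : k * y < x + g * (y - 1)) {s t : ℝ} (e1 : ((0 : ℤ) - k : ℝ) * s +
      ((0 : ℤ) - (1 : ℤ)) * t ≤ 0) (e2 : (g - k : ℝ) * s + ((0 : ℤ) - (1 : ℤ)) * t ≤ 0)
    (e3 : (x - k : ℝ) * s + (y - (1 : ℤ)) * t ≤ 0) : s = 0 ∧ t = 0 := by
  push_cast at e1 e2 e3
  have hy' : (2 : ℝ) ≤ y := by exact_mod_cast hy
  have h1' : (x : ℝ) < k * y := by exact_mod_cast h1
  have h2' : (k : ℝ) * y < x + g * (y - 1) := by exact_mod_cast h2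
  have p1 := mul_le_mul_of_nonneg_left e1 (by linarith : (0 : ℝ) ≤ y - 1)
  have p2 := mul_le_mul_of_nonneg_left e2 (by linarith : (0 : ℝ) ≤ y - 1)
  have s1 : (x - k * y : ℝ) * s ≤ 0 := by linarith
  have s2 : (x + g * (y - 1) - k * y : ℝ) * s ≤ 0 := by linarith
  have s0 : s = 0 := by
    refine le_antisymm ?_ ?_
    · by_contra! h
      exact absurd (mul_pos (by linarith : (0 : ℝ) < x + g * (y - 1) - k * y) h) (by linarith)
    · by_contra! h
      exact absurd (mul_pos_of_neg_of_neg (by linarith : (x - k * y : ℝ) < 0) h) (by linarith)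
  subst s0
  refine ⟨rfl, le_antisymm ?_ (by linarith)⟩
  by_contra! h
  have := mul_pos (by linarith : (0 : ℝ) < y - 1) h
  linarith

/-- Without an interior lattice point at height 1, all heights are at most 2, and height 2 carries
just one point. With at most three points on the base, at least three lie at height 1, and one of
them is far enough out to make a boundary lattice point interior. -/
theorem exists_surrounded_of_nonneg {B : Finset (ℤ × ℤ)} {g : ℤ} (hg : 2 ≤ g) (h0 : (0, 0) ∈ B)
    (hgB : (g, 0) ∈ B) (hB : 7 ≤ B.card) (hline : ∀ y, (B.filter fun b => b.2 = y).card ≤ 3)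
    (hpos : ∀ b ∈ B, 0 ≤ b.2) :
    ∃ q : ℤ × ℤ, ∀ s t : ℝ, (∀ b ∈ B, ((b.1 : ℝ) - q.1) * s + (b.2 - q.2) * t ≤ 0) →
      s = 0 ∧ t = 0 := by
  by_contra! hcon
  have hcon' : ∀ k l : ℤ, ¬ ∀ s t : ℝ, (∀ b ∈ B, ((b.1 : ℝ) - k) * s + (b.2 - l) * t ≤ 0) →
      s = 0 ∧ t = 0 := fun k l h => by
    obtain ⟨s, t, h1, h2⟩ := hcon (k, l)
    exact h2 (h s t h1).1 (h s t h1).2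
  have tri : ∀ b ∈ B, 2 ≤ b.2 → ∀ k, b.1 < k * b.2 → ¬ k * b.2 < b.1 + g * (b.2 - 1) :=
    fun b hb hb2 k h1 h2 => hcon' k 1 fun s t h =>
      exists_interior_of_le_height hb2 h1 h2 (h _ h0) (h _ hgB) (h b hb)
  -- From height 3 on, the segment at height 1 is longer than 1 and has an integer inside.
  have hle2 : ∀ b ∈ B, b.2 ≤ 2 := by
    intro b hb
    by_contra! h3
    refine tri b hb h3.le (b.1 / b.2 + 1) ?_ ?_
    · have := Int.lt_ediv_add_one_mul_self b.1 (by omega : 0 < b.2)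
      linarith
    · have := Int.ediv_mul_le b.1 (by omega : b.2 ≠ 0)
      nlinarith
  -- At height 2 the segment has length `g / 2`; it misses the integers only if its length is 1 and
  -- its ends are integers.
  have heven : ∀ b ∈ B, b.2 = 2 → g = 2 ∧ ∃ m, b.1 = 2 * m := by
    intro b hb h2
    have h := tri b hb h2.ge
    have h1 := h (b.1 / 2 + 1)
    rw [h2] at h1
    constructor
    · by_contra hne
      exact h1 (by omega) (by omega)
    · refine ⟨b.1 / 2, ?_⟩
      by_contra hne
      exact h1 (by omega) (by omega)
  have hpart : B.card = (B.filter fun b => b.2 = 0).card + (B.filter fun b => b.2 = 1).card +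
      (B.filter fun b => b.2 = 2).card := by
    rw [← Finset.card_union_of_disjoint, ← Finset.card_union_of_disjoint]
    · congr 1
      ext b
      simp only [Finset.mem_union, Finset.mem_filter]
      constructor
      · intro hb
        have := hpos b hb
        have := hle2 b hb
        have : b.2 = 0 ∨ b.2 = 1 ∨ b.2 = 2 := by omega
        tauto
      · tauto
    · rw [Finset.disjoint_left]
      intro b hb hb'
      simp only [Finset.mem_union, Finset.mem_filter] at hb hb'
      omega
    · rw [Finset.disjoint_left]
      intro b hb hb'
      simp only [Finset.mem_filter] at hb hb'
      omega
  have l0 := hline 0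
  have l1 := hline 1
  obtain ⟨c, hc⟩ : (B.filter fun b => b.2 = 2).Nonempty := by
    rw [← Finset.card_pos]; omega
  obtain ⟨hcB, hc2⟩ := Finset.mem_filter.1 hc
  obtain ⟨rfl, m, hm⟩ := heven c hcB hc2
  have hcm : c = (2 * m, 2) := Prod.ext hm hc2
  subst hcm
  have huniq : ∀ b ∈ B, b.2 = 2 → ¬ 2 * m < b.1 := by
    intro b hb hb2 hlt
    obtain ⟨-, m', hm'⟩ := heven b hb hb2
    refine hcon' (m + 1) 1 fun s t h => ?_
    have e1 := h _ h0
    have e2 := h _ hgB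
    have e3 := h _ hcB
    have e4 := h _ hb
    rw [hb2, hm'] at e4
    have hmm : (m : ℝ) + 1 ≤ m' := by exact_mod_cast (by omega : m + 1 ≤ m')
    push_cast at e1 e2 e3 e4
    have ht : t = (1 - m) * s := by linarith
    subst ht
    have hs : s = 0 := by
      refine le_antisymm ?_ (by linarith)
      by_contra! hs
      nlinarith
    simp [hs]
  have huniq' : ∀ b ∈ B, b.2 = 2 → ¬ b.1 < 2 * m := by
    intro b hb hb2 hlt
    obtain ⟨-, m', hm'⟩ := heven b hb hb2
    refine hcon' (m' + 1) 1 fun s t h => ?_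
    have e1 := h _ h0
    have e2 := h _ hgB
    have e3 := h _ hcB
    have e4 := h _ hb
    rw [hb2, hm'] at e4
    have hmm : (m' : ℝ) + 1 ≤ m := by exact_mod_cast (by omega : m' + 1 ≤ m)
    push_cast at e1 e2 e3 e4
    have ht : t = (1 - m') * s := by linarith
    subst ht
    have hs : s = 0 := by
      refine le_antisymm ?_ (by linarith)
      by_contra! hs
      nlinarith
    simp [hs]
  have hone : (B.filter fun b => b.2 = 2).card ≤ 1 := by
    refine Finset.card_le_one.2 fun a ha b hb => ?_
    obtain ⟨haB, ha2⟩ := Finset.mem_filter.1 ha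
    obtain ⟨hbB, hb2⟩ := Finset.mem_filter.1 hb
    have := huniq a haB ha2
    have := huniq' a haB ha2
    have := huniq b hbB hb2
    have := huniq' b hbB hb2
    exact Prod.ext (by omega) (by omega)
  -- The triangle with apex `(2 * m, 2)` meets height 1 in the segment from `m` to `m + 1`. A third
  -- point on that row makes one of these ends interior.
  have hthree : ¬ (B.filter fun b => b.2 = 1) ⊆ {(m, 1), (m + 1, 1)} := fun hsub => by
    have := (Finset.card_le_card hsub).trans Finset.card_le_two
    omega
  obtain ⟨b, hb, hbn⟩ := Finset.not_subset.1 hthree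
  obtain ⟨hbB, hb1⟩ := Finset.mem_filter.1 hb
  obtain ⟨z, y⟩ := b
  simp only at hb1
  subst hb1
  have hz : z ≤ m - 1 ∨ m + 2 ≤ z := by
    by_contra! hz
    have : z = m ∨ z = m + 1 := by omega
    rcases this with rfl | rfl <;> simp at hbn
  rcases hz with hz | hz
  · refine hcon' m 1 fun s t h => ?_
    have e1 := h _ h0
    have e2 := h _ hgB
    have e3 := h _ hcB
    have e4 := h _ hbB
    have hz' : (z : ℝ) + 1 ≤ m := by exact_mod_cast (by omega : z + 1 ≤ m)
    push_cast at e1 e2 e3 e4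
    have ht : t = -m * s := by linarith
    subst ht
    have hs : s = 0 := by
      refine le_antisymm (by linarith) ?_
      by_contra! hs
      nlinarith
    simp [hs]
  · refine hcon' (m + 1) 1 fun s t h => ?_
    have e1 := h _ h0
    have e2 := h _ hgB
    have e3 := h _ hcB
    have e4 := h _ hbB
    have hz' : (m : ℝ) + 2 ≤ z := by exact_mod_cast hz
    push_cast at e1 e2 e3 e4
    have ht : t = (1 - m) * s := by linarith
    subst ht
    have hs : s = 0 := by
      refine le_antisymm ?_ (by linarith)
      by_contra! hs
      nlinarith
    simp [hs]

theorem exists_surrounded_of_card_filter_le {B : Finset (ℤ × ℤ)} {g : ℤ} (hg : 2 ≤ g)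
    (h0 : (0, 0) ∈ B) (hgB : (g, 0) ∈ B) (hB : 7 ≤ B.card)
    (hline : ∀ y, (B.filter fun b => b.2 = y).card ≤ 3) :
    ∃ q : ℤ × ℤ, ∀ s t : ℝ, (∀ b ∈ B, ((b.1 : ℝ) - q.1) * s + (b.2 - q.2) * t ≤ 0) →
      s = 0 ∧ t = 0 := by
  by_cases hpos : ∀ b ∈ B, 0 ≤ b.2
  · exact exists_surrounded_of_nonneg hg h0 hgB hB hline hpos
  by_cases hneg : ∀ b ∈ B, b.2 ≤ 0
  · let f : ℤ × ℤ → ℤ × ℤ := fun b => (b.1, -b.2)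
    have hf : Function.Injective f := fun a b hab => by
      simp only [f, Prod.mk.injEq, neg_inj] at hab
      exact Prod.ext hab.1 hab.2
    have hfil : ∀ y, ((B.image f).filter fun b => b.2 = y) = (B.filter fun b => b.2 = -y).image f :=
      fun y => by
        rw [Finset.filter_image]
        simp only [f, neg_eq_iff_eq_neg]
    obtain ⟨q, hq⟩ := exists_surrounded_of_nonneg (B := B.image f) hg
      (Finset.mem_image.2 ⟨_, h0, rfl⟩) (Finset.mem_image.2 ⟨_, hgB, by simp [f]⟩)
      (by rwa [Finset.card_image_of_injective _ hf])
      (fun y => by rw [hfil]; exact Finset.card_image_le.trans (hline _))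
      (fun b hb => by
        obtain ⟨a, ha, rfl⟩ := Finset.mem_image.1 hb
        simpa [f] using hneg a ha)
    refine ⟨(q.1, -q.2), fun s t h => ?_⟩
    obtain ⟨h1, h2⟩ := hq s (-t) fun b hb => by
      obtain ⟨a, ha, rfl⟩ := Finset.mem_image.1 hb
      have := h a ha
      simp only [f] at this ⊢
      push_cast at this ⊢
      linarith
    exact ⟨h1, by linarith⟩
  push Not at hpos hneg
  obtain ⟨b, hb, hb2⟩ := hpos
  obtain ⟨c, hc, hc2⟩ := hneg
  -- With points on both sides of the base line, `(1, 0)` is interior because it lies strictly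
  -- between `(0, 0)` and `(g, 0)`.
  refine ⟨(1, 0), fun s t h => ?_⟩
  have e1 := h _ h0
  have e2 := h _ hgB
  have e3 := h _ hb
  have e4 := h _ hc
  have hg' : (2 : ℝ) ≤ g := by exact_mod_cast hg
  have hb' : (b.2 : ℝ) < 0 := by exact_mod_cast hb2
  have hc' : (0 : ℝ) < c.2 := by exact_mod_cast hc2
  push_cast at e1 e2 e3 e4
  have hs : s = 0 := by
    refine le_antisymm ?_ (by linarith)
    by_contra! hs
    nlinarith
  subst hs
  refine ⟨rfl, le_antisymm ?_ ?_⟩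
  · by_contra! ht
    nlinarith
  · by_contra! ht
    nlinarith

/-- Seven lattice points in the plane, no four of them on a line, surround a lattice point. -/
theorem exists_surrounds_or_collinear {A : Finset (Fin 2 → ℤ)} (hA : A.card = 7) :
    (∃ q, Surrounds latticePoint A q) ∨
      ∃ a e : Fin 2 → ℤ, IsCoprime (e 0) (e 1) ∧ ∃ X ⊆ A, 4 ≤ X.card ∧
        ∀ x ∈ X, ∃ n : ℤ, x = a + n • e := by
  classical
  -- Seven points fall into four classes modulo 2, so some difference `b - a` is `g` times a
  -- primitive vector with `g ≥ 2`.
  obtain ⟨a, ha, b, hb, hab, hred⟩ := Finset.exists_ne_map_eq_of_card_lt_of_maps_to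
    (s := A) (t := (Finset.univ : Finset (Fin 2 → ZMod 2))) (by simp [hA]) (f := reduce 2)
    (fun _ _ => Finset.mem_coe.2 (Finset.mem_univ _))
  have h0 := reduce_eq_iff.1 hred.symm 0
  have h1 := reduce_eq_iff.1 hred.symm 1
  have hgpos : 0 < Int.gcd (b 0 - a 0) (b 1 - a 1) := by
    rw [Int.gcd_pos_iff]
    by_contra! h
    refine hab (funext fun i => ?_)
    fin_cases i
    · have := h.1; simp; omega
    · have := h.2; simp; omega
  have hg2 : (2 : ℤ) ≤ Int.gcd (b 0 - a 0) (b 1 - a 1) :=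
    Int.le_of_dvd (by exact_mod_cast hgpos) (Int.dvd_coe_gcd (by simpa using h0) (by simpa using h1))
  obtain ⟨e0, e1, hcop, hb0, hb1⟩ := Int.exists_gcd_one hgpos
  set g : ℤ := (Int.gcd (b 0 - a 0) (b 1 - a 1) : ℤ)
  rw [← Int.isCoprime_iff_gcd_eq_one] at hcop
  obtain ⟨w0, w1, hw⟩ := hcop
  -- Unimodular coordinates sending `a` to the origin and `b` to `(g, 0)`.
  let F : (Fin 2 → ℤ) → ℤ × ℤ := fun x =>
    ((x 0 - a 0) * w0 + (x 1 - a 1) * w1, e0 * (x 1 - a 1) - e1 * (x 0 - a 0))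
  have hF0 : ∀ x, x 0 = a 0 + (F x).1 * e0 - (F x).2 * w1 := fun x => by
    simp only [F]; linear_combination (a 0 - x 0) * hw
  have hF1 : ∀ x, x 1 = a 1 + (F x).1 * e1 + (F x).2 * w0 := fun x => by
    simp only [F]; linear_combination (a 1 - x 1) * hw
  have hFinj : Function.Injective F := fun x y hxy => by
    funext i
    fin_cases i
    · simp only [Fin.zero_eta, hF0 x, hF0 y, hxy]
    · simp only [Fin.mk_one, hF1 x, hF1 y, hxy]
  by_cases hline : ∀ y, ((A.image F).filter fun b => b.2 = y).card ≤ 3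
  · left
    obtain ⟨q, hq⟩ := exists_surrounded_of_card_filter_le hg2
      (Finset.mem_image.2 ⟨a, ha, by simp [F]⟩)
      (Finset.mem_image.2 ⟨b, hb, by
        simp only [F, hb0, hb1, Prod.mk.injEq]
        exact ⟨by linear_combination g * hw, by ring⟩⟩)
      (by rw [Finset.card_image_of_injective _ hFinj, hA]) hline
    refine ⟨![a 0 + q.1 * e0 - q.2 * w1, a 1 + q.1 * e1 + q.2 * w0], fun y hy => ?_⟩
    by_contra! hcon
    obtain ⟨hs, ht⟩ := hq (y 0 * e0 + y 1 * e1) (y 1 * w0 - y 0 * w1) fun c hc => by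
      obtain ⟨x, hx, rfl⟩ := Finset.mem_image.1 hc
      have := hcon x hx
      simp only [PiLp.inner_apply, Fin.sum_univ_two, PiLp.sub_apply, latticePoint_apply,
        Matrix.cons_val_zero, Matrix.cons_val_one, hF0 x, hF1 x] at this
      simp at this
      linarith
    have hw' : (w0 * e0 + w1 * e1 : ℝ) = 1 := by exact_mod_cast hw
    refine hy (PiLp.ext fun i => ?_)
    fin_cases i
    · simp only [Fin.zero_eta, PiLp.zero_apply]
      linear_combination w0 * hs - e1 * ht - y 0 * hw'
    · simp only [Fin.mk_one, PiLp.zero_apply]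
      linear_combination w1 * hs + e0 * ht - y 1 * hw'
  · right
    push Not at hline
    obtain ⟨y, hy⟩ := hline
    refine ⟨![a 0 - y * w1, a 1 + y * w0], ![e0, e1], ⟨w0, w1, by simpa using hw⟩,
      A.filter fun x => (F x).2 = y, Finset.filter_subset _ _, ?_, fun x hx => ⟨(F x).1, ?_⟩⟩
    · rw [Finset.filter_image] at hy
      exact hy.trans_le Finset.card_image_le
    · have hxy := (Finset.mem_filter.1 hx).2
      funext i
      fin_cases i
      · have h := hF0 x
        rw [hxy] at h
        simp only [Fin.zero_eta, Pi.add_apply, Pi.smul_apply, smul_eq_mul, Matrix.cons_val_zero]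
        linarith
      · have h := hF1 x
        rw [hxy] at h
        simp only [Fin.mk_one, Pi.add_apply, Pi.smul_apply, smul_eq_mul, Matrix.cons_val_one,
          Matrix.cons_val_fin_one]
        linarith

end PlanarLattice

/-! ### Four lattice points on a line. -/

section CollinearLattice

theorem reduce_add_smul_eq_iff {a e : Fin 2 → ℤ} (he : IsCoprime (e 0) (e 1)) {m : ℕ} {n k : ℤ} :
    reduce m (a + n • e) = reduce m (a + k • e) ↔ (m : ℤ) ∣ n - k := by
  rw [reduce_eq_iff]
  constructor
  · intro h
    obtain ⟨u, v, huv⟩ := he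
    have h0 := (h 0).mul_right u
    have h1 := (h 1).mul_right v
    have := dvd_add h0 h1
    simp only [Pi.add_apply, Pi.smul_apply, smul_eq_mul, add_sub_add_left_eq_sub] at this
    rwa [show (n * e 0 - k * e 0) * u + (n * e 1 - k * e 1) * v = n - k by
      linear_combination (n - k) * huv] at this
  · intro h i
    simp only [Pi.add_apply, Pi.smul_apply, smul_eq_mul, add_sub_add_left_eq_sub, ← sub_mul]
    exact h.mul_right _

theorem latticePoint_sub_latticePoint {a e : Fin 2 → ℤ} {n k : ℤ} :
    latticePoint (a + n • e) - latticePoint (a + k • e) = ((n : ℝ) - k) • latticePoint e := by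
  ext i
  simp
  ring

/-- A point between two points of a line is balanced. -/
theorem balancedAt_pair {a e : Fin 2 → ℤ} {l m n : ℤ} (hlm : l < m) (hmn : m < n) :
    BalancedAt latticePoint {a + l • e, a + n • e} (a + m • e) ∧
      latticePoint e ∈ spread latticePoint {a + l • e, a + n • e} (a + m • e) := by
  have h1 : (0 : ℝ) < m - l := by exact_mod_cast sub_pos.2 hlm
  have h2 : (0 : ℝ) < n - m := by exact_mod_cast sub_pos.2 hmn
  constructor
  · by_cases hne : a + l • e = a + n • e
    · have he : e = 0 := by
        have : (n - l) • e = 0 := by rw [sub_smul, sub_eq_zero]; exact (add_left_cancel hne).symm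
        exact (smul_eq_zero.1 this).resolve_left (by omega)
      subst he
      exact ⟨fun _ => 1, by simp, by simp⟩
    classical
    refine ⟨fun x => if x = a + l • e then n - m else m - l, fun x _ => ?_, ?_⟩
    · beta_reduce
      split_ifs <;> assumption
    · rw [Finset.sum_pair hne]
      beta_reduce
      rw [if_pos rfl, if_neg (Ne.symm hne), latticePoint_sub_latticePoint,
        latticePoint_sub_latticePoint, smul_smul, smul_smul, ← add_smul]
      rw [show ((n : ℝ) - m) * (l - m) + (m - l) * (n - m) = 0 by ring, zero_smul]
  · have h := sub_mem_spread (π := latticePoint) (q := a + m • e)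
      (Finset.mem_insert_self (a + l • e) {a + n • e})
    rw [latticePoint_sub_latticePoint] at h
    exact (Submodule.smul_mem_iff _ (by linarith : (l : ℝ) - m < 0).ne).1 h

/-- Among four points of a line, congruent modulo `2 ^ j` but not modulo `2 ^ (j + 1)`, some two have
a point between them in any prescribed one of the two residue classes. -/
theorem exists_between_of_four_le_card {P : Finset ℤ} (hP : 4 ≤ P.card) {j : ℕ}
    (hj : ∀ x ∈ P, ∀ y ∈ P, ((2 ^ j : ℕ) : ℤ) ∣ x - y)
    {b : ℤ} (hb : b ∈ P) :
    ∃ l ∈ P, ∃ n ∈ P, ∃ m, l < m ∧ m < n ∧ ((2 ^ (j + 1) : ℕ) : ℤ) ∣ m - b := by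
  classical
  -- Two points outside the class of `b` differ from `b` by odd multiples of `2 ^ j`, so `x + 2 ^ j`
  -- lies between them and in that class. Otherwise three points lie in the class, and a middle one
  -- serves.
  by_cases h2 : 1 < (P.filter fun x => ¬ ((2 ^ (j + 1) : ℕ) : ℤ) ∣ x - b).card
  · obtain ⟨x, hx, y, hy, hxy⟩ := Finset.one_lt_card.1 h2
    wlog hlt : x < y generalizing x y
    · exact this y hy x hx hxy.symm (by omega)
    obtain ⟨hxP, hxb⟩ := Finset.mem_filter.1 hx
    obtain ⟨hyP, hyb⟩ := Finset.mem_filter.1 hy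
    obtain ⟨k, hk⟩ := hj x hxP b hb
    obtain ⟨k', hk'⟩ := hj y hyP b hb
    push_cast [pow_succ] at hxb hyb hk hk' ⊢
    rw [hk, mul_dvd_mul_iff_left (by positivity)] at hxb
    rw [hk', mul_dvd_mul_iff_left (by positivity)] at hyb
    have hpos : (0 : ℤ) < 2 ^ j := by positivity
    have hkk : k + 1 < k' := by
      have : k < k' := by
        by_contra! hle
        have := mul_le_mul_of_nonneg_left hle hpos.le
        omega
      omega
    refine ⟨x, hxP, y, hyP, x + 2 ^ j, by omega, ?_, ?_⟩
    · have := mul_lt_mul_of_pos_left hkk hpos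
      linarith
    · rw [show x + 2 ^ j - b = 2 ^ j * (k + 1) by linear_combination hk]
      exact mul_dvd_mul_left _ (by omega)
  · have hcard := Finset.card_filter_add_card_filter_not (s := P)
      fun x => ((2 ^ (j + 1) : ℕ) : ℤ) ∣ x - b
    set Q := P.filter fun x => ((2 ^ (j + 1) : ℕ) : ℤ) ∣ x - b with hQ
    have hQ3 : 3 ≤ Q.card := by omega
    have hne : Q.Nonempty := Finset.card_pos.1 (by omega)
    obtain ⟨m, hm⟩ : (Q.erase (Q.min' hne) |>.erase (Q.max' hne)).Nonempty := by
      rw [← Finset.card_pos]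
      have h1 := Finset.pred_card_le_card_erase (s := Q) (a := Q.min' hne)
      have h2 := Finset.pred_card_le_card_erase (s := Q.erase (Q.min' hne)) (a := Q.max' hne)
      omega
    simp only [Finset.mem_erase] at hm
    obtain ⟨h1, h2, hmQ⟩ := hm
    exact ⟨Q.min' hne, Finset.filter_subset _ _ (Q.min'_mem hne), Q.max' hne,
      Finset.filter_subset _ _ (Q.max'_mem hne), m,
      lt_of_le_of_ne (Q.min'_le m hmQ) (Ne.symm h2), lt_of_le_of_ne (Q.le_max' m hmQ) h1,
      (Finset.mem_filter.1 hmQ).2⟩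

/-- Four lattice points of a line are separated, on both sides, from suitable points between
them. -/
theorem exists_separates_of_collinear {a e : Fin 2 → ℤ} (he : IsCoprime (e 0) (e 1))
    {X : Finset (Fin 2 → ℤ)} (hX : 4 ≤ X.card) (hline : ∀ x ∈ X, ∃ n : ℤ, x = a + n • e) :
    ∃ j, (∃ x ∈ X, ∃ y ∈ X, reduce (2 ^ (j + 1)) x ≠ reduce (2 ^ (j + 1)) y) ∧
      ∀ b ∈ X, ∃ C ⊆ X, C.Nonempty ∧ ∃ m : ℤ, BalancedAt latticePoint C (a + m • e) ∧
        latticePoint e ∈ spread latticePoint C (a + m • e) ∧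
        (∀ x ∈ X, reduce (2 ^ j) x = reduce (2 ^ j) (a + m • e)) ∧
        reduce (2 ^ (j + 1)) (a + m • e) = reduce (2 ^ (j + 1)) b := by
  classical
  obtain ⟨j, h1, h2⟩ := exists_split_level le_rfl (by omega : 1 < X.card)
  refine ⟨j, h2, fun b hb => ?_⟩
  choose! n hn using hline
  have hred : ∀ k, ∀ x ∈ X, ∀ m : ℤ, (reduce (2 ^ k) (a + m • e) = reduce (2 ^ k) x ↔
      ((2 ^ k : ℕ) : ℤ) ∣ m - n x) := fun k x hx m => by
    conv_lhs => rw [hn x hx]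
    exact reduce_add_smul_eq_iff he
  have hinj : Set.InjOn n X := fun x hx y hy hxy => by rw [hn x hx, hn y hy, hxy]
  obtain ⟨l, hl, k, hk, m, hlm, hmk, hmb⟩ := exists_between_of_four_le_card (P := X.image n) (j := j)
    (by rwa [Finset.card_image_of_injOn hinj]) (fun x hx y hy => by
      obtain ⟨x, hxX, rfl⟩ := Finset.mem_image.1 hx
      obtain ⟨y, hyX, rfl⟩ := Finset.mem_image.1 hy
      rw [← hred j y hyX, ← hn x hxX]
      exact h1 x hxX y hyX) (Finset.mem_image_of_mem n hb)
  obtain ⟨x, hx, rfl⟩ := Finset.mem_image.1 hl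
  obtain ⟨y, hy, rfl⟩ := Finset.mem_image.1 hk
  obtain ⟨hbal, hspr⟩ := balancedAt_pair (a := a) (e := e) hlm hmk
  rw [← hred (j + 1) b hb] at hmb
  refine ⟨{a + n x • e, a + n y • e}, ?_, Finset.insert_nonempty _ _, m, hbal, hspr,
    fun z hz => ?_, hmb⟩
  · rw [← hn x hx, ← hn y hy]
    exact Finset.insert_subset hx (Finset.singleton_subset_iff.2 hy)
  · exact (h1 z hz b hb).trans (reduce_pow_eq_of_le (Nat.le_succ j) hmb).symm

end CollinearLattice

/-! ### Surrounding with the help of an extra vector. -/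

section Planar

/-- The vectors `π a - π q`, `a ∈ A`, together with `w`, meet every open half-space. -/
def SurroundsWith {ι E : Type*} [NormedAddCommGroup E] [InnerProductSpace ℝ E] (w : E) (π : ι → E)
    (A : Finset ι) (q : ι) : Prop :=
  ∀ y : E, y ≠ 0 → (∃ a ∈ A, 0 < inner ℝ y (π a - π q)) ∨ 0 < inner ℝ y w

theorem SurroundsWith.of_near {ι E : Type*} [NormedAddCommGroup E] [InnerProductSpace ℝ E]
    [FiniteDimensional ℝ E] [Nontrivial E] {w : E} {π : ι → E} {A : Finset ι} {q : ι}
    (h : SurroundsWith w π A q) :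
    ∃ ε : ℝ, 0 < ε ∧ ∀ π' : ι → E, (∀ a ∈ A, ‖π' a - π a‖ < ε) → ‖π' q - π q‖ < ε →
      SurroundsWith w π' A q := by
  classical
  -- The vector `w` is treated as one more point, `π q + w`, which moves along with `q`.
  let P : (ι → E) → Option ι → E := fun π o => o.elim (π q + w) π
  have hP : Surrounds (P π) (insert none (A.image some)) (some q) := by
    intro y hy
    rcases h y hy with ⟨a, ha, h1⟩ | h1
    · exact ⟨some a, by simp [ha], h1⟩
    · exact ⟨none, by simp, by simpa [P] using h1⟩
  obtain ⟨ε, hε, H⟩ := hP.of_near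
  refine ⟨ε, hε, fun π' h1 h2 y hy => ?_⟩
  obtain ⟨o, ho, h3⟩ := H (P π') (fun o ho => by
    rcases Finset.mem_insert.1 ho with rfl | ho
    · simpa [P] using h2
    · obtain ⟨a, ha, rfl⟩ := Finset.mem_image.1 ho
      exact h1 a ha) h2 y hy
  rcases Finset.mem_insert.1 ho with rfl | ho
  · exact Or.inr (by simpa [P] using h3)
  · obtain ⟨a, ha, rfl⟩ := Finset.mem_image.1 ho
    exact Or.inl ⟨a, ha, h3⟩

theorem exists_surroundsWith_of_near {ι E : Type*} [NormedAddCommGroup E] [InnerProductSpace ℝ E]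
    [FiniteDimensional ℝ E] [Nontrivial E] (G : Finset ι) (W : Finset E) (π : ι → E) :
    ∃ ε : ℝ, 0 < ε ∧ ∀ A ⊆ G, ∀ q ∈ G, ∀ w ∈ W, SurroundsWith w π A q →
      ∀ π' : ι → E, (∀ z ∈ G, ‖π' z - π z‖ < ε) → SurroundsWith w π' A q := by
  have key : ∀ A ∈ G.powerset, ∀ q ∈ G, ∀ w ∈ W, ∀ᶠ ε in nhdsWithin (0 : ℝ) (Set.Ioi 0),
      SurroundsWith w π A q → ∀ π' : ι → E, (∀ z ∈ G, ‖π' z - π z‖ < ε) →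
        SurroundsWith w π' A q := by
    intro A hA q hq w _
    by_cases hs : SurroundsWith w π A q
    · obtain ⟨ε, hε, H⟩ := hs.of_near
      filter_upwards [Ioo_mem_nhdsGT hε] with η hη _ π' hπ'
      exact H π' (fun a ha => (hπ' a (Finset.mem_powerset.1 hA ha)).trans hη.2)
        ((hπ' q hq).trans hη.2)
    · simp [hs]
  obtain ⟨ε, h1, h2⟩ := (((Finset.eventually_all _).2 fun A hA => (Finset.eventually_all _).2
    fun q hq => (Finset.eventually_all _).2 fun w hw => key A hA q hq w hw).and
    self_mem_nhdsWithin).exists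
  exact ⟨ε, h2, fun A hA q hq w hw => h1 A (Finset.mem_powerset.2 hA) q hq w hw⟩

/-- The tilted relation makes a positive multiple of `σ • v` a positive combination of vectors of
the moved family, which can therefore replace the extra vector. -/
theorem SurroundsWith.surrounds_of_tiltedAt {ι E : Type*} [NormedAddCommGroup E]
    [InnerProductSpace ℝ E] {σ : ℝ} {v : E} {π : ι → E} {h : ι → ℝ} {A C : Finset ι} {q : ι}
    (H : SurroundsWith (σ • v) (fun x => π x + h x • v) A q) (hC : TiltedAt σ h π C q)
    (hCA : C ⊆ A) : Surrounds (fun x => π x + h x • v) A q := by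
  intro y hy
  refine (H y hy).elim id fun hpos => ?_
  obtain ⟨t, ht, hs, hh⟩ := hC
  by_contra! hcon
  have h1 := congrArg (inner ℝ y) (sum_smul_sub_eq_smul h v hs)
  simp only [inner_sum, real_inner_smul_right] at h1 hpos
  have h2 : ∑ a ∈ C, t a * inner ℝ y ((π a + h a • v) - (π q + h q • v)) ≤ 0 :=
    Finset.sum_nonpos fun a ha => mul_nonpos_of_nonneg_of_nonpos (ht a ha).le (hcon a (hCA ha))
  rw [h1] at h2
  have h3 := mul_pos hh hpos
  have h4 : 0 ≤ σ * σ := mul_self_nonneg σ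
  nlinarith

theorem Surrounds.mem_box {d R : ℕ} {A : Finset (Fin d → ℤ)} {q : Fin d → ℤ}
    (h : Surrounds latticePoint A q) (hA : A ⊆ box d R) : q ∈ box d R := by
  refine _root_.mem_box.2 fun i => abs_le.2 ⟨?_, ?_⟩
  · obtain ⟨a, ha, h1⟩ := h (EuclideanSpace.single i (-1)) (by simp)
    have h2 : a i < q i := by
      have : (a i : ℝ) < q i := by simpa [EuclideanSpace.inner_single_left] using h1
      exact_mod_cast this
    have := (abs_le.1 (_root_.mem_box.1 (hA ha) i)).1
    omega
  · obtain ⟨a, ha, h1⟩ := h (EuclideanSpace.single i 1) (by simp)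
    have h2 : q i < a i := by
      have : (q i : ℝ) < a i := by simpa [EuclideanSpace.inner_single_left] using h1
      exact_mod_cast this
    have := (abs_le.1 (_root_.mem_box.1 (hA ha) i)).2
    omega

theorem inner_latticePoint (y : EuclideanSpace ℝ (Fin 2)) (e : Fin 2 → ℤ) :
    inner ℝ y (latticePoint e) = y 0 * e 0 + y 1 * e 1 := by
  simp [PiLp.inner_apply, Fin.sum_univ_two]
  ring

/-- A vector orthogonal to a primitive lattice vector. -/
theorem exists_eq_mul_of_inner_eq_zero {e : Fin 2 → ℤ} (he : IsCoprime (e 0) (e 1))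
    {y : EuclideanSpace ℝ (Fin 2)} (hy : inner ℝ y (latticePoint e) = 0) :
    ∃ c : ℝ, y 0 = -c * e 1 ∧ y 1 = c * e 0 := by
  obtain ⟨w0, w1, hw⟩ := he
  have hw' : (w0 * e 0 + w1 * e 1 : ℝ) = 1 := by exact_mod_cast hw
  rw [inner_latticePoint] at hy
  exact ⟨y 1 * w0 - y 0 * w1, by linear_combination w0 * hy - y 0 * hw',
    by linear_combination w1 * hy - y 1 * hw'⟩

/-- A point in the middle of a line, a point off the line and a vector pointing to the other side
of the line. -/
theorem BalancedAt.surroundsWith {e u q : Fin 2 → ℤ} (he : IsCoprime (e 0) (e 1))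
    {C A : Finset (Fin 2 → ℤ)} (hC : BalancedAt latticePoint C q)
    (heC : latticePoint e ∈ spread latticePoint C q) (hCA : C ⊆ A) (huA : u ∈ A) {w : Fin 2 → ℤ}
    (hw : (e 0 * (u 1 - q 1) - e 1 * (u 0 - q 0)) * (e 0 * w 1 - e 1 * w 0) < 0) :
    SurroundsWith (latticePoint w) latticePoint A q := by
  intro y hy
  by_contra! hcon
  have h1 := hC.inner_eq_zero (fun a ha => hcon.1 a (hCA ha)) heC
  obtain ⟨c, hc0, hc1⟩ := exists_eq_mul_of_inner_eq_zero he h1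
  have h2 := hcon.1 u huA
  have h3 := hcon.2
  rw [inner_sub_right] at h2
  simp only [inner_latticePoint, hc0, hc1] at h2 h3
  have hw' : ((e 0 * (u 1 - q 1) - e 1 * (u 0 - q 0)) * (e 0 * w 1 - e 1 * w 0) : ℝ) < 0 := by
    exact_mod_cast hw
  have h2' : c * (e 0 * (u 1 - q 1) - e 1 * (u 0 - q 0)) ≤ 0 := by linarith
  have h3' : c * (e 0 * w 1 - e 1 * w 0) ≤ 0 := by linarith
  have h4 := mul_nonneg_of_nonpos_of_nonpos h2' h3'
  have hc : c = 0 := by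
    by_contra hne
    have := mul_neg_of_pos_of_neg (mul_self_pos.2 hne) hw'
    linarith
  refine hy (PiLp.ext fun i => ?_)
  fin_cases i
  · simpa [hc] using hc0
  · simpa [hc] using hc1

/-- Place the point in the class of highest rank at the level where `X` splits; the other class lies
below. The last clause keeps the point in any class containing `X`, so a point outside that class
can separate too. -/
theorem exists_separatesBelow_of_collinear {a e : Fin 2 → ℤ} (he : IsCoprime (e 0) (e 1))
    {X : Finset (Fin 2 → ℤ)} (hX : 4 ≤ X.card) (hline : ∀ x ∈ X, ∃ n : ℤ, x = a + n • e) :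
    ∃ C ⊆ X, C.Nonempty ∧ ∃ m : ℤ, BalancedAt latticePoint C (a + m • e) ∧
      latticePoint e ∈ spread latticePoint C (a + m • e) ∧
      SeparatesBelow (rank 2) X X (a + m • e) ∧
      ∀ k, (∀ x ∈ X, ∀ y ∈ X, reduce (2 ^ k) x = reduce (2 ^ k) y) →
        ∀ x ∈ X, reduce (2 ^ k) x = reduce (2 ^ k) (a + m • e) := by
  obtain ⟨j, ⟨x, hx, y, hy, hxy⟩, H⟩ := exists_separates_of_collinear he hX hline
  obtain ⟨b, hb, hmax⟩ := Finset.exists_max_image X (rank 2 j) ⟨x, hx⟩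
  obtain ⟨C, hCX, hC, m, h1, h2, h3, h4⟩ := H b hb
  refine ⟨C, hCX, hC, m, h1, h2, ?_, fun k hk z hz => ?_⟩
  · obtain ⟨u, hu, hub⟩ : ∃ u ∈ X, rank 2 j u ≠ rank 2 j b := by
      by_contra! hcon
      exact hxy (rank_eq_iff.1 ((hcon x hx).trans (hcon y hy).symm))
    have h5 : rank 2 j (a + m • e) = rank 2 j b := rank_eq_iff.2 h4
    refine ⟨j, u, hu, fun l hl => rank_eq_of_reduce_eq hl (h3 u hu), ?_,
      fun z hz => ⟨fun l hl => rank_eq_of_reduce_eq hl (h3 z hz), h5 ▸ hmax z hz⟩⟩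
    rw [h5]
    exact lt_of_le_of_ne (hmax u hu) hub
  · have hkj : k ≤ j := by
      by_contra! hlt
      exact hxy (reduce_pow_eq_of_le hlt (hk x hx y hy))
    exact reduce_pow_eq_of_le hkj (h3 z hz)

theorem exists_separatesAbove_of_collinear {a e : Fin 2 → ℤ} (he : IsCoprime (e 0) (e 1))
    {X : Finset (Fin 2 → ℤ)} (hX : 4 ≤ X.card) (hline : ∀ x ∈ X, ∃ n : ℤ, x = a + n • e) :
    ∃ C ⊆ X, C.Nonempty ∧ ∃ m : ℤ, BalancedAt latticePoint C (a + m • e) ∧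
      latticePoint e ∈ spread latticePoint C (a + m • e) ∧
      SeparatesAbove (rank 2) X X (a + m • e) ∧
      ∀ k, (∀ x ∈ X, ∀ y ∈ X, reduce (2 ^ k) x = reduce (2 ^ k) y) →
        ∀ x ∈ X, reduce (2 ^ k) x = reduce (2 ^ k) (a + m • e) := by
  obtain ⟨j, ⟨x, hx, y, hy, hxy⟩, H⟩ := exists_separates_of_collinear he hX hline
  obtain ⟨b, hb, hmin⟩ := Finset.exists_min_image X (rank 2 j) ⟨x, hx⟩
  obtain ⟨C, hCX, hC, m, h1, h2, h3, h4⟩ := H b hb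
  refine ⟨C, hCX, hC, m, h1, h2, ?_, fun k hk z hz => ?_⟩
  · obtain ⟨u, hu, hub⟩ : ∃ u ∈ X, rank 2 j u ≠ rank 2 j b := by
      by_contra! hcon
      exact hxy (rank_eq_iff.1 ((hcon x hx).trans (hcon y hy).symm))
    have h5 : rank 2 j (a + m • e) = rank 2 j b := rank_eq_iff.2 h4
    refine ⟨j, u, hu, fun l hl => rank_eq_of_reduce_eq hl (h3 u hu), ?_,
      fun z hz => ⟨fun l hl => rank_eq_of_reduce_eq hl (h3 z hz), h5 ▸ hmin z hz⟩⟩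
    rw [h5]
    exact lt_of_le_of_ne (hmin u hu) hub.symm
  · have hkj : k ≤ j := by
      by_contra! hlt
      exact hxy (reduce_pow_eq_of_le hlt (hk x hx y hy))
    exact reduce_pow_eq_of_le hkj (h3 z hz)

end Planar

/-! ### The planar perturbation without 7-holes. -/

section PlanarPerturbation

theorem SeparatesBelow.mono {ι : Type*} {w : ℕ → ι → ℕ} {C C' B B' : Finset ι} {q : ι}
    (h : SeparatesBelow w C B q) (hC : C' ⊆ C) (hB : B ⊆ B') : SeparatesBelow w C' B' q := by
  obtain ⟨j, u, hu, h1, h2, h3⟩ := h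
  exact ⟨j, u, hB hu, h1, h2, fun a ha => h3 a (hC ha)⟩

theorem SeparatesAbove.mono {ι : Type*} {w : ℕ → ι → ℕ} {C C' B B' : Finset ι} {q : ι}
    (h : SeparatesAbove w C B q) (hC : C' ⊆ C) (hB : B ⊆ B') : SeparatesAbove w C' B' q := by
  obtain ⟨j, u, hu, h1, h2, h3⟩ := h
  exact ⟨j, u, hB hu, h1, h2, fun a ha => h3 a (hC ha)⟩

/-- Among seven lattice points of a line, at least four belong to one of the two residue classes
into which they split. -/
theorem exists_four_le_card_class {a e : Fin 2 → ℤ} (he : IsCoprime (e 0) (e 1))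
    {A : Finset (Fin 2 → ℤ)} (hA : A.card = 7) (hline : ∀ x ∈ A, ∃ n : ℤ, x = a + n • e) :
    ∃ j, (∀ x ∈ A, ∀ y ∈ A, reduce (2 ^ j) x = reduce (2 ^ j) y) ∧ ∃ X ⊆ A, 4 ≤ X.card ∧
      (∀ x ∈ X, ∀ y ∈ X, reduce (2 ^ (j + 1)) x = reduce (2 ^ (j + 1)) y) ∧
      ∃ u ∈ A, ∀ x ∈ X, reduce (2 ^ (j + 1)) u ≠ reduce (2 ^ (j + 1)) x := by
  classical
  obtain ⟨j, h1, b, hb, c, hc, hbc⟩ := exists_split_level le_rfl (by omega : 1 < A.card)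
  refine ⟨j, h1, ?_⟩
  have hcard := Finset.card_filter_add_card_filter_not (s := A)
    fun x => reduce (2 ^ (j + 1)) x = reduce (2 ^ (j + 1)) b
  by_cases h4 : 4 ≤ (A.filter fun x => reduce (2 ^ (j + 1)) x = reduce (2 ^ (j + 1)) b).card
  · refine ⟨_, Finset.filter_subset _ _, h4, fun x hx y hy => ?_, c, hc, fun x hx h => ?_⟩
    · exact (Finset.mem_filter.1 hx).2.trans (Finset.mem_filter.1 hy).2.symm
    · exact hbc (h.trans (Finset.mem_filter.1 hx).2).symm
  · refine ⟨A.filter fun x => ¬ reduce (2 ^ (j + 1)) x = reduce (2 ^ (j + 1)) b,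
      Finset.filter_subset _ _, by omega, fun x hx y hy => ?_, b, hb, fun x hx h => ?_⟩
    · obtain ⟨hxA, hx⟩ := Finset.mem_filter.1 hx
      obtain ⟨hyA, hy⟩ := Finset.mem_filter.1 hy
      have hxb := h1 x hxA b hb
      have hyb := h1 y hyA b hb
      obtain ⟨k, rfl⟩ := hline x hxA
      obtain ⟨l, rfl⟩ := hline y hyA
      obtain ⟨n, rfl⟩ := hline b hb
      rw [reduce_add_smul_eq_iff he] at hx hy hxb hyb ⊢
      obtain ⟨s, hs⟩ := hxb
      obtain ⟨t, ht⟩ := hyb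
      push_cast [pow_succ] at hx hy hs ht ⊢
      rw [hs, mul_dvd_mul_iff_left (by positivity)] at hx
      rw [ht, mul_dvd_mul_iff_left (by positivity)] at hy
      rw [show k - l = 2 ^ j * (s - t) by linear_combination hs - ht]
      exact mul_dvd_mul_left _ (by omega)
    · exact (Finset.mem_filter.1 hx).2 h.symm

theorem exists_eq_add_smul_of_det_eq_zero {a e u : Fin 2 → ℤ} (he : IsCoprime (e 0) (e 1))
    (h : e 0 * (u 1 - a 1) - e 1 * (u 0 - a 0) = 0) : ∃ n : ℤ, u = a + n • e := by
  obtain ⟨w0, w1, hw⟩ := he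
  refine ⟨w0 * (u 0 - a 0) + w1 * (u 1 - a 1), funext fun i => ?_⟩
  fin_cases i
  · simp only [Fin.zero_eta, Pi.add_apply, Pi.smul_apply, smul_eq_mul]
    linear_combination (a 0 - u 0) * hw - w1 * h
  · simp only [Fin.mk_one, Pi.add_apply, Pi.smul_apply, smul_eq_mul]
    linear_combination (a 1 - u 1) * hw + w0 * h

/-- The direction `(1, 2 * R + 1)` is too steep to be parallel to a line through two points of the
cube. -/
theorem det_ne_zero_of_mem_box {R : ℕ} {a e : Fin 2 → ℤ} (he : IsCoprime (e 0) (e 1))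
    {X : Finset (Fin 2 → ℤ)} (hX : 4 ≤ X.card) (hXR : X ⊆ box 2 R)
    (hline : ∀ x ∈ X, ∃ n : ℤ, x = a + n • e) : e 0 * (2 * R + 1) - e 1 * 1 ≠ 0 := by
  obtain ⟨x, hx, y, hy, hxy⟩ := Finset.one_lt_card.1 (by omega : 1 < X.card)
  have hx1 := abs_le.1 (mem_box.1 (hXR hx) 1)
  have hy1 := abs_le.1 (mem_box.1 (hXR hy) 1)
  obtain ⟨k, rfl⟩ := hline x hx
  obtain ⟨l, rfl⟩ := hline y hy
  have hkl : 1 ≤ |k - l| := Int.one_le_abs (sub_ne_zero.2 fun h => hxy (h ▸ rfl))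
  have h1 : |(k - l) * e 1| ≤ 2 * R := by
    simp only [Pi.add_apply, Pi.smul_apply, smul_eq_mul] at hx1 hy1
    rw [abs_le, sub_mul]
    constructor <;> linarith [hx1.1, hx1.2, hy1.1, hy1.2]
  rw [abs_mul] at h1
  have h2 : |e 1| ≤ 2 * R := (le_mul_of_one_le_left (abs_nonneg _) hkl).trans h1
  intro h
  have h3 : e 1 = e 0 * (2 * R + 1) := by linarith
  rcases eq_or_ne (e 0) 0 with h0 | h0
  · rw [h3, h0, zero_mul] at he
    exact not_isCoprime_zero_zero he
  · rw [h3, abs_mul, abs_of_pos (by positivity : (0 : ℤ) < 2 * R + 1)] at h2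
    nlinarith [Int.one_le_abs h0]

/-- A perturbation of a large square of `ℤ²` without `7`-holes. -/
theorem exists_crowded_perturbation_plane (R : ℕ) :
    ∃ π : (Fin 2 → ℤ) → EuclideanSpace ℝ (Fin 2),
      (∀ z ∈ box 2 R, ‖π z - latticePoint z‖ ≤ 1) ∧ Crowded π (box 2 R) 7 := by
  classical
  let V : Fin 2 → ℤ := ![1, 2 * R + 1]
  set v := latticePoint V with hv
  -- The tolerance is fixed before the height. The vector `0` covers sets that already surround a
  -- lattice point; `v` and `-v` cover the one-sided tilts.
  obtain ⟨ε, hε, hnear⟩ := exists_surroundsWith_of_near (box 2 R)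
    {0, (1 : ℝ) • v, (-1 : ℝ) • v} latticePoint
  have hδ : 0 < min 1 ε / (‖v‖ + 1) := by positivity
  obtain ⟨h, hsmall, hh⟩ := exists_tilting_height (box 2 R) latticePoint (rank 2) hδ
    (lt_of_rank_ne le_rfl)
  have hdist : ∀ z ∈ box 2 R, ‖(latticePoint z + h z • v) - latticePoint z‖ < min 1 ε := by
    intro z hz
    rw [add_sub_cancel_left, norm_smul]
    have h1 : min 1 ε / (‖v‖ + 1) * (‖v‖ + 1) = min 1 ε := div_mul_cancel₀ _ (by positivity)
    have h2 := mul_le_mul_of_nonneg_right (hsmall z hz) (norm_nonneg v)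
    rw [Real.norm_eq_abs]
    linarith
  have hdist' : ∀ z ∈ box 2 R, ‖(latticePoint z + h z • v) - latticePoint z‖ < ε :=
    fun z hz => (hdist z hz).trans_le (min_le_right _ _)
  refine ⟨fun z => latticePoint z + h z • v, fun z hz => (hdist z hz).le.trans (min_le_left _ _),
    fun A hA hcard => ?_⟩
  rcases exists_surrounds_or_collinear hcard with ⟨q, hq⟩ | ⟨a, e, he, X, hXA, hX, hline⟩
  · have hqR := hq.mem_box hA
    refine ⟨q, hqR, fun y hy => ?_⟩
    have := hnear A hA q hqR 0 (by simp) (fun y hy => Or.inl (hq y hy)) _ hdist' y hy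
    simpa using this
  have hdet := det_ne_zero_of_mem_box he hX (hXA.trans hA) hline
  have hspread : ∀ {C : Finset (Fin 2 → ℤ)} {m : ℤ},
      latticePoint e ∈ spread latticePoint C (a + m • e) → ∀ u, (∃ n : ℤ, u = a + n • e) →
      latticePoint u - latticePoint (a + m • e) ∈ spread latticePoint C (a + m • e) := by
    rintro C m hC _ ⟨n, rfl⟩
    rw [latticePoint_sub_latticePoint]
    exact Submodule.smul_mem _ _ hC
  -- If all seven points are collinear, the tilt has to go both ways; a point off the line provides
  -- one side and leaves only one tilt to find.
  by_cases hall : ∀ x ∈ A, ∃ n : ℤ, x = a + n • e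
  · have key : ∀ C ⊆ A, C.Nonempty → ∀ m : ℤ, BalancedAt latticePoint C (a + m • e) →
        latticePoint e ∈ spread latticePoint C (a + m • e) →
        SeparatesBelow (rank 2) C A (a + m • e) → SeparatesAbove (rank 2) C A (a + m • e) →
        ∃ q ∈ box 2 R, Surrounds (fun z => latticePoint z + h z • v) A q := by
      intro C hCA hC m hb hs hbelow habove
      have hq := hb.mem_box hC (hCA.trans hA)
      obtain ⟨g1, g2⟩ := hh C (hCA.trans hA) A hA _ hq hb fun u hu => hspread hs u (hall u hu)
      obtain ⟨u₁, hu₁, H₁⟩ := g1 hbelow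
      obtain ⟨u₂, hu₂, H₂⟩ := g2 habove
      obtain ⟨b1, b2, b3⟩ := H₁.balancedAt v H₂
      have hsub : insert u₁ C ∪ insert u₂ C ⊆ A := Finset.union_subset
        (Finset.insert_subset hu₁ hCA) (Finset.insert_subset hu₂ hCA)
      refine ⟨_, hq, Surrounds.mono (fun y hy => ?_) hsub⟩
      by_contra! hcon
      have e1 := b1.inner_eq_zero hcon b2
      have e2 := b1.inner_eq_zero hcon (b3 (spread_mono
        ((Finset.subset_insert u₁ C).trans Finset.subset_union_left) hs))
      obtain ⟨c, hc0, hc1⟩ := exists_eq_mul_of_inner_eq_zero he e2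
      rw [hv, inner_latticePoint, hc0, hc1] at e1
      have e3 : c * ((e 0 * (2 * R + 1) - e 1 * 1 : ℤ) : ℝ) = 0 := by
        simp [V] at e1
        push_cast
        linarith
      have hc : c = 0 := (mul_eq_zero.1 e3).resolve_right (by exact_mod_cast hdet)
      refine hy (PiLp.ext fun i => ?_)
      fin_cases i
      · simpa [hc] using hc0
      · simpa [hc] using hc1
    obtain ⟨j, hj, X, hXA, hX, hXj, u, hu, hne⟩ := exists_four_le_card_class he hcard hall
    obtain ⟨x₀, hx₀⟩ := Finset.card_pos.1 (by omega : 0 < X.card)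
    -- The point `u` of the other class separates on one side, and the splitting of the four points
    -- of `X` on the other.
    rcases Nat.lt_or_gt_of_ne (mt rank_eq_iff.1 (hne x₀ hx₀)) with hlt | hlt
    · obtain ⟨C, hCX, hC, m, h1, h2, h3, h4⟩ := exists_separatesAbove_of_collinear he hX
        fun x hx => hall x (hXA hx)
      have hXq := h4 (j + 1) hXj
      refine key C (hCX.trans hXA) hC m h1 h2 ⟨j, u, hu, fun l hl => ?_, ?_, fun z hz =>
        ⟨fun l hl => rank_eq_of_reduce_eq (by omega) (hXq z (hCX hz)),
          (rank_eq_iff.2 (hXq z (hCX hz))).le⟩⟩ (h3.mono hCX hXA)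
      · exact rank_eq_of_reduce_eq hl ((hj u hu x₀ (hXA hx₀)).trans
          (reduce_pow_eq_of_le (Nat.le_succ j) (hXq x₀ hx₀)))
      · rwa [← rank_eq_iff.2 (hXq x₀ hx₀)]
    · obtain ⟨C, hCX, hC, m, h1, h2, h3, h4⟩ := exists_separatesBelow_of_collinear he hX
        fun x hx => hall x (hXA hx)
      have hXq := h4 (j + 1) hXj
      refine key C (hCX.trans hXA) hC m h1 h2 (h3.mono hCX hXA) ⟨j, u, hu, fun l hl => ?_, ?_,
        fun z hz => ⟨fun l hl => rank_eq_of_reduce_eq (by omega) (hXq z (hCX hz)),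
          (rank_eq_iff.2 (hXq z (hCX hz))).ge⟩⟩
      · exact rank_eq_of_reduce_eq hl ((hj u hu x₀ (hXA hx₀)).trans
          (reduce_pow_eq_of_le (Nat.le_succ j) (hXq x₀ hx₀)))
      · rwa [← rank_eq_iff.2 (hXq x₀ hx₀)]
  · push Not at hall
    obtain ⟨u, hu, hun⟩ := hall
    have hdu : e 0 * (u 1 - a 1) - e 1 * (u 0 - a 0) ≠ 0 := fun h0 =>
      let ⟨n, hn⟩ := exists_eq_add_smul_of_det_eq_zero he h0
      hun n hn
    have hshift : ∀ m : ℤ, e 0 * (u 1 - (a + m • e) 1) - e 1 * (u 0 - (a + m • e) 0) =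
        e 0 * (u 1 - a 1) - e 1 * (u 0 - a 0) := fun m => by
      simp only [Pi.add_apply, Pi.smul_apply, smul_eq_mul]; ring
    -- The sign tells whether `v` or `-v` points across the line, away from `u`, and so which tilt
    -- is wanted.
    rcases lt_or_gt_of_ne (mul_ne_zero hdu hdet) with hlt | hlt
    · obtain ⟨C, hCX, hC, m, h1, h2, h3, -⟩ := exists_separatesAbove_of_collinear he hX hline
      have hq := h1.mem_box hC (hCX.trans (hXA.trans hA))
      obtain ⟨u', hu', H⟩ := (hh C (hCX.trans (hXA.trans hA)) X (hXA.trans hA) _ hq h1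
        fun x hx => hspread h2 x (hline x hx)).2 (h3.mono hCX subset_rfl)
      have hs : SurroundsWith ((1 : ℝ) • v) latticePoint A (a + m • e) := by
        rw [one_smul]
        exact h1.surroundsWith he h2 (hCX.trans hXA) hu (by rw [hshift]; exact hlt)
      exact ⟨_, hq, (hnear A hA _ hq _ (by simp) hs _ hdist').surrounds_of_tiltedAt H
        (Finset.insert_subset (hXA hu') (hCX.trans hXA))⟩
    · obtain ⟨C, hCX, hC, m, h1, h2, h3, -⟩ := exists_separatesBelow_of_collinear he hX hline
      have hq := h1.mem_box hC (hCX.trans (hXA.trans hA))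
      obtain ⟨u', hu', H⟩ := (hh C (hCX.trans (hXA.trans hA)) X (hXA.trans hA) _ hq h1
        fun x hx => hspread h2 x (hline x hx)).1 (h3.mono hCX subset_rfl)
      have hs : SurroundsWith ((-1 : ℝ) • v) latticePoint A (a + m • e) := by
        have hneg : (-1 : ℝ) • v = latticePoint (-V) := by
          ext i; simp [hv]
        rw [hneg]
        refine h1.surroundsWith he h2 (hCX.trans hXA) hu ?_
        rw [hshift]
        simp only [V, Pi.neg_apply, Matrix.cons_val_zero, Matrix.cons_val_one,
          Matrix.cons_val_fin_one]
        linarith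
      exact ⟨_, hq, (hnear A hA _ hq _ (by simp) hs _ hdist').surrounds_of_tiltedAt H
        (Finset.insert_subset (hXA hu') (hCX.trans hXA))⟩

end PlanarPerturbation

/-! ### The theorem. -/

theorem theorem1 :
    ∃ C : ℕ → ℕ,
      (∃ K : ℕ, ∀ d : ℕ, 2 ≤ d → C d ≤ d ^ (K * d ^ 3)) ∧
      C 2 = 9 ∧
      ∀ d : ℕ, 2 ≤ d → ∀ S : Finset (EuclideanSpace ℝ (Fin d)),
        InGeneralPosition (S : Set (EuclideanSpace ℝ (Fin d))) →
        ∀ n : ℕ, ∃ T : Finset (EuclideanSpace ℝ (Fin d)),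
          S ⊆ T ∧ n ≤ T.card ∧
          InGeneralPosition (T : Set (EuclideanSpace ℝ (Fin d))) ∧
          HoleFree (C d) (T : Set (EuclideanSpace ℝ (Fin d))) := by
  let N : ℕ → ℕ := fun d => ∏ i ∈ Finset.range d, Nat.nth Nat.Prime i
  refine ⟨fun d => if d = 2 then 9 else ((N d * (N d * (d + 1))) ^ d) ^ d + 1 + d,
    ⟨12, fun d hd => ?_⟩, rfl, fun d hd S hS n => ?_⟩
  · rcases eq_or_ne d 2 with rfl | h2
    · norm_num
    · simp only [h2, if_false]
      exact crowding_constant_le (by omega) rfl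
  · rcases eq_or_ne d 2 with rfl | h2
    · exact exists_holeFree_superset (c := 7) two_ne_zero exists_crowded_perturbation_plane S hS n
    · simp only [h2, if_false]
      exact exists_holeFree_superset (by omega) (exists_crowded_perturbation (by omega)
        two_le_nth_prime (fun _ _ _ _ => coprime_nth_prime) rfl) S hS n
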